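/- Let $V$ be a finite-dimensional Euclidean space and let $W\subset O(V)$ be a finite reflection group, i.e. a finite group generated by orthogonal reflections (in hyperplanes). Let $C$ be a fundamental cone of $W$, i.e. the closure of a connected component of the complement of the union of the mirrors (reflecting hyperplanes) of $W$. For a polyhedral cone $K$ let $\langle K\rangle$ be its linear span and $\sigma(K)=\operatorname{vol}(K\cap B)/\operatorname{vol}(B)$, with $B$ the unit ball of $\langle K\rangle$, its relative angle measure. For a face $F$ of $C$ let $C/F$ be the orthogonal projection of $C$ to $\langle F\rangle^\perp$, and let $(C/F)^*=\{v\in\langle F\rangle^\perp : (v,u)\ge 0\ \forall u\in C/F\}$ be its dual cone in $\langle F\rangle^\perp$. Let $W_F$ be the subgroup of $W$ fixing $\langle F\rangle$ pointwise, $W_F^{\mathrm{reg}}$ the set of elements of $W_F$ that have no nonzero fixed vector in $\langle F\rangle^\perp$, and $N_F=\{w\in W: w\langle F\rangle=\langle F\rangle\}$. For $k\ge 0$ put $W^k=\{w\in W:\dim\ker(1-w)=k\}$. Call two $k$-dimensional faces $F,F'$ of $C$ equivalent, $F\sim F'$, if $w\langle F\rangle=\langle F'\rangle$ for some $w\in W$.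 Then $C$ has only finitely many $k$-dimensional faces, and: 1. for every $k$-dimensional face $F$ of $C$, $$\sum_{F'\sim F}\sigma(F')=\frac{|W_F|}{|N_F|},$$ where $F'$ runs over the $k$-dimensional faces of $C$ equivalent to $F$; 2. if $F$ runs over a set of representatives of the equivalence classes of $k$-dimensional faces of $C$, then $$\sum_{F}\frac{|W_F^{\mathrm{reg}}|}{|N_F|}=\sum_F\Big(\sum_{F'\sim F}\sigma(F')\Big)\,\sigma\big((C/F)^*\big)=\frac{|W^k|}{|W|}.$$ -/

import Mathlib

open MeasureTheory
open scoped RealInnerProductSpace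

noncomputable section

namespace AngleMeasure

variable {E : Type*} [NormedAddCommGroup E] [InnerProductSpace ℝ E] [FiniteDimensional ℝ E]

/-! ### Angle measures of cones -/

/-- The proportion of the unit ball of a Euclidean space that is occupied by a set. -/
def ballFraction [MeasurableSpace E] [BorelSpace E] (S : Set E) : ℝ :=
  (volume (S ∩ Metric.closedBall (0 : E) 1)).toReal / (volume (Metric.closedBall (0 : E) 1)).toReal

/-- The linear span of a cone. -/
def linSpan (C : PointedCone ℝ E) : Submodule ℝ E := Submodule.span ℝ (C : Set E)

/-- The relative angle measure of a cone: the proportion that it occupies of the unit ball of its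
own linear span. -/
def relAngle [MeasurableSpace E] [BorelSpace E] (C : PointedCone ℝ E) : ℝ :=
  ballFraction {x : linSpan C | (x : E) ∈ C}

/-- The cone `C / F`: the orthogonal projection of `C` to the orthogonal complement of the span
of `F`. -/
def quotCone (C F : PointedCone ℝ E) : PointedCone ℝ (linSpan F)ᗮ :=
  PointedCone.map ((linSpan F)ᗮ.orthogonalProjectionOnto : E →ₗ[ℝ] (linSpan F)ᗮ) C

/-- The dual cone `{v | ⟪v, u⟫ ≥ 0 for all u ∈ C}`. -/
def dualCone (C : PointedCone ℝ E) : PointedCone ℝ E :=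
  (ProperCone.innerDual (C : Set E) : ProperCone ℝ E).toSubmodule

/-! ### Finite reflection groups -/

/-- The orthogonal reflection in the hyperplane orthogonal to `v` (for `v ≠ 0`). -/
abbrev refl (v : E) : E ≃ₗᵢ[ℝ] E := (ℝ ∙ v)ᗮ.reflection

/-- A finite group of isometries that is generated by reflections. -/
structure IsFiniteReflectionGroup (W : Subgroup (E ≃ₗᵢ[ℝ] E)) : Prop where
  finite : Finite W
  generated : ∃ S : Set (E ≃ₗᵢ[ℝ] E), (∀ s ∈ S, ∃ v : E, v ≠ 0 ∧ s = refl v) ∧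
    W = Subgroup.closure S

/-- The complement of the union of the mirrors of `W`. -/
def mirrorCompl (W : Subgroup (E ≃ₗᵢ[ℝ] E)) : Set E :=
  {x | ∀ v : E, v ≠ 0 → refl v ∈ W → ⟪v, x⟫ ≠ 0}

/-- `C` is a fundamental cone of `W` (a closed chamber): for some point `x` on no mirror, `C`
consists of the points that lie on the same closed side as `x` of every mirror. -/
def IsFundamentalCone (W : Subgroup (E ≃ₗᵢ[ℝ] E)) (C : PointedCone ℝ E) : Prop :=
  ∃ x ∈ mirrorCompl W, ∀ y : E, y ∈ C ↔ ∀ v : E, refl v ∈ W → 0 ≤ ⟪v, x⟫ * ⟪v, y⟫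

/-- Fundamental cones are the closures of the connected components of the complement of the
mirrors. -/
theorem isFundamentalCone_iff (W : Subgroup (E ≃ₗᵢ[ℝ] E)) (C : PointedCone ℝ E) :
    IsFundamentalCone W C ↔
      ∃ x ∈ mirrorCompl W, (C : Set E) = closure (connectedComponentIn (mirrorCompl W) x) := by
  have key : ∀ x ∈ mirrorCompl W, closure (connectedComponentIn (mirrorCompl W) x) =
      {y | ∀ v : E, refl v ∈ W → 0 ≤ ⟪v, x⟫ * ⟪v, y⟫} := by
    intro x hx
    have hcomp : connectedComponentIn (mirrorCompl W) x =
        {y | ∀ v : E, v ≠ 0 → refl v ∈ W → 0 < ⟪v, x⟫ * ⟪v, y⟫} := by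
      apply Set.Subset.antisymm
      · intro y hy v hv hvW
        by_contra hneg
        have hpre := isPreconnected_connectedComponentIn (x := x) (F := mirrorCompl W)
        have hxm := mem_connectedComponentIn hx
        have hc : ContinuousOn (fun z : E => ⟪v, x⟫ * ⟪v, z⟫)
            (connectedComponentIn (mirrorCompl W) x) := by fun_prop
        have h0 : (0 : ℝ) ∈ Set.Icc (⟪v, x⟫ * ⟪v, y⟫) (⟪v, x⟫ * ⟪v, x⟫) :=
          ⟨not_lt.mp hneg, mul_self_nonneg _⟩
        obtain ⟨z, hz, hz0⟩ := hpre.intermediate_value hy hxm hc h0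
        rcases mul_eq_zero.mp hz0 with h | h
        · exact hx v hv hvW h
        · exact connectedComponentIn_subset _ _ hz v hv hvW h
      · apply IsPreconnected.subset_connectedComponentIn
        · refine Convex.isPreconnected ?_
          intro y hy z hz a b ha hb hab v hv hvW
          have h1 := hy v hv hvW
          have h2 := hz v hv hvW
          rw [inner_add_right, real_inner_smul_right, real_inner_smul_right]
          rcases ha.eq_or_lt with rfl | ha'
          · have : b = 1 := by linarith
            subst this
            simpa using h2
          · nlinarith [mul_pos ha' h1, mul_nonneg hb h2.le]
        · exact fun v hv hvW => mul_self_pos.mpr (hx v hv hvW)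
        · intro y hy v hv hvW h
          have := hy v hv hvW
          rw [h, mul_zero] at this
          exact lt_irrefl _ this
    rw [hcomp]
    apply Set.Subset.antisymm
    · apply closure_minimal
      · intro y hy v hvW
        by_cases hv : v = 0
        · simp [hv]
        · exact (hy v hv hvW).le
      · have : {y | ∀ v : E, refl v ∈ W → 0 ≤ ⟪v, x⟫ * ⟪v, y⟫} =
            ⋂ v : E, ⋂ _ : refl v ∈ W, {y | 0 ≤ ⟪v, x⟫ * ⟪v, y⟫} := by
          ext y; simp
        rw [this]
        exact isClosed_iInter fun v => isClosed_iInter fun _ =>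
          isClosed_le continuous_const (by fun_prop)
    · intro y hy
      have hc : Filter.Tendsto (fun t : ℝ => y + t • x) (nhdsWithin 0 (Set.Ioi 0)) (nhds y) := by
        have : Filter.Tendsto (fun t : ℝ => y + t • x) (nhds 0) (nhds (y + (0 : ℝ) • x)) :=
          Continuous.tendsto (by fun_prop) 0
        rw [zero_smul, add_zero] at this
        exact this.mono_left nhdsWithin_le_nhds
      refine mem_closure_of_tendsto hc ?_
      filter_upwards [self_mem_nhdsWithin] with t ht v hv hvW
      have h1 := hy v hvW
      have h2 := mul_pos (Set.mem_Ioi.mp ht) (mul_self_pos.mpr (hx v hv hvW))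
      rw [inner_add_right, real_inner_smul_right]
      nlinarith
  refine exists_congr fun x => and_congr_right fun hx => ?_
  rw [key x hx, Set.ext_iff]
  rfl

/-- The fixed space `ker (1 - w)`. -/
def fixedSpace (w : E ≃ₗᵢ[ℝ] E) : Submodule ℝ E :=
  LinearMap.ker (LinearMap.id - (w.toLinearEquiv : E →ₗ[ℝ] E))

/-- `W^k`: the elements of `W` whose fixed space has dimension `k`. -/
def fixDimSet (W : Subgroup (E ≃ₗᵢ[ℝ] E)) (k : ℕ) : Set (E ≃ₗᵢ[ℝ] E) :=
  {w | w ∈ W ∧ Module.finrank ℝ (fixedSpace w) = k}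

/-- `W_U`: the subgroup of `W` that fixes the subspace `U` pointwise. -/
def pointFixer (W : Subgroup (E ≃ₗᵢ[ℝ] E)) (U : Submodule ℝ E) : Subgroup (E ≃ₗᵢ[ℝ] E) where
  carrier := {w | w ∈ W ∧ ∀ u ∈ U, w u = u}
  one_mem' := ⟨W.one_mem, fun _ _ => rfl⟩
  mul_mem' := fun {a b} ha hb => ⟨W.mul_mem ha.1 hb.1, fun u hu => by
    change a (b u) = u
    rw [hb.2 u hu, ha.2 u hu]⟩
  inv_mem' := fun {a} ha => ⟨W.inv_mem ha.1, fun u hu => by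
    conv_lhs => rw [← ha.2 u hu]
    exact a.symm_apply_apply u⟩

/-- The regular elements of `W_U`, a reflection group that is regarded as acting on the orthogonal
complement of `U`: the elements of `W_U` without nonzero fixed vectors in that complement. -/
def regSet (W : Subgroup (E ≃ₗᵢ[ℝ] E)) (U : Submodule ℝ E) : Set (E ≃ₗᵢ[ℝ] E) :=
  {w | w ∈ pointFixer W U ∧ fixedSpace w ⊓ Uᗮ = ⊥}

/-- The image `w U` of a subspace. -/
abbrev image (w : E ≃ₗᵢ[ℝ] E) (U : Submodule ℝ E) : Submodule ℝ E :=
  U.map (w.toLinearEquiv : E →ₗ[ℝ] E)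

/-- The subgroup of `W` that maps the subspace `U` onto itself. -/
def normalizer (W : Subgroup (E ≃ₗᵢ[ℝ] E)) (U : Submodule ℝ E) : Subgroup (E ≃ₗᵢ[ℝ] E) where
  carrier := {w | w ∈ W ∧ image w U = U}
  one_mem' := ⟨W.one_mem, Submodule.map_id U⟩
  mul_mem' := fun {a b} ha hb => ⟨W.mul_mem ha.1 hb.1, by
    have h : image (a * b) U = image a (image b U) := Submodule.map_comp _ _ U
    rw [h, hb.2, ha.2]⟩
  inv_mem' := fun {a} ha => ⟨W.inv_mem ha.1, by
    have h : image (a⁻¹ * a) U = image a⁻¹ (image a U) := Submodule.map_comp _ _ U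
    rw [ha.2, inv_mul_cancel] at h
    exact h.symm.trans (Submodule.map_id U)⟩

/-! ### Faces -/

/-- The `k`-dimensional faces of a cone. -/
def faces (C : PointedCone ℝ E) (k : ℕ) : Set (PointedCone ℝ E) :=
  {F | F.IsFaceOf C ∧ Module.finrank ℝ (linSpan F) = k}

/-- Two faces are equivalent if some element of `W` maps the linear span of the first onto the
linear span of the second. -/
def FaceEquiv (W : Subgroup (E ≃ₗᵢ[ℝ] E)) (F F' : PointedCone ℝ E) : Prop :=
  ∃ w ∈ W, image w (linSpan F) = linSpan F'

/-- `R` contains exactly one representative of every equivalence class of `k`-dimensional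
faces of `C`. -/
def IsFaceTransversal (W : Subgroup (E ≃ₗᵢ[ℝ] E)) (C : PointedCone ℝ E) (k : ℕ)
    (R : Finset (PointedCone ℝ E)) : Prop :=
  (∀ F ∈ R, F ∈ faces C k) ∧ ∀ F ∈ faces C k, ∃! F', F' ∈ R ∧ FaceEquiv W F F'

/-- The sum of the relative angle measures of the faces of `C` that are equivalent to `F`. -/
def classAngle [MeasurableSpace E] [BorelSpace E] (W : Subgroup (E ≃ₗᵢ[ℝ] E))
    (C F : PointedCone ℝ E) (k : ℕ) : ℝ :=
  ∑ᶠ F' ∈ {F' | F' ∈ faces C k ∧ FaceEquiv W F F'}, relAngle F'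

end AngleMeasure

end

open MeasureTheory
open scoped RealInnerProductSpace

noncomputable section

namespace AngleMeasure

section Roots

variable {E : Type*} [NormedAddCommGroup E] [InnerProductSpace ℝ E]

theorem refl_apply_of_norm {v : E} (hv : ‖v‖ = 1) (x : E) :
    refl v x = x - (2 * ⟪v, x⟫) • v := by
  rw [Submodule.reflection_orthogonal_apply, Submodule.reflection_singleton_apply]
  simp [hv, mul_smul, two_smul]

theorem refl_self (v : E) : refl v v = -v :=
  Submodule.reflection_orthogonalComplement_singleton_eq_neg v

theorem refl_refl (v x : E) : refl v (refl v x) = x :=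
  Submodule.reflection_reflection _ x

theorem refl_eq_self_iff (v x : E) : refl v x = x ↔ ⟪v, x⟫ = 0 := by
  rw [Submodule.reflection_eq_self_iff, Submodule.mem_orthogonal_singleton_iff_inner_right]

theorem refl_smul {c : ℝ} (hc : c ≠ 0) (v : E) : refl (c • v) = refl v := by
  have h : (ℝ ∙ (c • v)) = (ℝ ∙ v) := Submodule.span_singleton_smul_eq (IsUnit.mk0 c hc) v
  unfold refl
  simp only [h]

theorem inner_refl_left (v x y : E) : ⟪refl v x, y⟫ = ⟪x, refl v y⟫ := by
  rw [← (refl v).inner_map_map (refl v x) y, refl_refl]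

theorem inner_isometry_left (w : E ≃ₗᵢ[ℝ] E) (x y : E) : ⟪w x, y⟫ = ⟪x, w⁻¹ y⟫ := by
  rw [← w.inner_map_map x (w⁻¹ y)]
  congr 1
  exact (w.apply_symm_apply y).symm

theorem inv_apply_self (w : E ≃ₗᵢ[ℝ] E) (x : E) : w⁻¹ (w x) = x := w.symm_apply_apply x

theorem apply_inv_self (w : E ≃ₗᵢ[ℝ] E) (x : E) : w (w⁻¹ x) = x := w.apply_symm_apply x

theorem refl_map (w : E ≃ₗᵢ[ℝ] E) {v : E} (hv : ‖v‖ = 1) :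
    refl (w v) = w * refl v * w⁻¹ := by
  ext x
  rw [refl_apply_of_norm (by simpa using hv)]
  change _ = w (refl v (w⁻¹ x))
  rw [refl_apply_of_norm hv, map_sub, map_smul, apply_inv_self, inner_isometry_left]

/-- The unit normals of the mirrors of `W`. -/
def unitRoots (W : Subgroup (E ≃ₗᵢ[ℝ] E)) : Set E := {v | ‖v‖ = 1 ∧ refl v ∈ W}

/-- The unit normals of the mirrors that lie on the same side as `x₀`. -/
def posRoots (W : Subgroup (E ≃ₗᵢ[ℝ] E)) (x₀ : E) : Set E :=
  {v | v ∈ unitRoots W ∧ 0 < ⟪v, x₀⟫}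

/-- The positive roots whose reflections permute the other positive roots. -/
def simpleRoots (W : Subgroup (E ≃ₗᵢ[ℝ] E)) (x₀ : E) : Set E :=
  {a | a ∈ posRoots W x₀ ∧ ∀ b ∈ posRoots W x₀, b ≠ a → refl a b ∈ posRoots W x₀}

/-- The closed chamber that contains `x₀`. -/
def chamber (W : Subgroup (E ≃ₗᵢ[ℝ] E)) (x₀ : E) : Set E :=
  {y | ∀ v ∈ posRoots W x₀, 0 ≤ ⟪v, y⟫}

variable {W : Subgroup (E ≃ₗᵢ[ℝ] E)} {x₀ : E}

theorem ne_zero_of_mem_unitRoots {v : E} (hv : v ∈ unitRoots W) : v ≠ 0 := by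
  rintro rfl
  simpa using hv.1

theorem eq_or_eq_neg_of_refl_eq {u v : E} (hu : ‖u‖ = 1) (hv : ‖v‖ = 1) (h : refl u = refl v) :
    u = v ∨ u = -v := by
  have h1 : refl v u = -u := by rw [← h, refl_self]
  rw [refl_apply_of_norm hv] at h1
  have h2 : u = ⟪v, u⟫ • v := by
    have : (2 : ℝ) • u = (2 : ℝ) • (⟪v, u⟫ • v) := by
      rw [smul_smul, two_smul, eq_comm, ← sub_eq_zero]
      rw [sub_eq_iff_eq_add] at h1
      nth_rw 2 [h1]
      abel
    exact smul_right_injective E two_ne_zero this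
  have h3 : |⟪v, u⟫| = 1 := by
    have := congrArg norm h2
    rw [norm_smul, hu, hv, mul_one] at this
    simpa using this.symm
  rcases (abs_eq zero_le_one).mp h3 with h4 | h4
  · left; rw [h2, h4, one_smul]
  · right; rw [h2, h4, neg_one_smul]

theorem finite_unitRoots [Finite W] : (unitRoots W).Finite := by
  have hW : (W : Set (E ≃ₗᵢ[ℝ] E)).Finite := Set.toFinite _
  refine Set.Finite.of_finite_fibers (fun v => refl v) (hW.subset ?_) ?_
  · rintro _ ⟨v, hv, rfl⟩
    exact hv.2
  · rintro s -
    rcases Set.eq_empty_or_nonempty (unitRoots W ∩ (fun v => refl v) ⁻¹' {s}) with h | ⟨u, hu, hus⟩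
    · rw [h]; exact Set.finite_empty
    · refine (Set.toFinite {u, -u}).subset ?_
      rintro v ⟨hv, hvs⟩
      exact eq_or_eq_neg_of_refl_eq hv.1 hu.1
        ((Set.mem_singleton_iff.mp hvs).trans (Set.mem_singleton_iff.mp hus).symm)

theorem map_mem_unitRoots {w : E ≃ₗᵢ[ℝ] E} (hw : w ∈ W) {v : E} (hv : v ∈ unitRoots W) :
    w v ∈ unitRoots W := by
  refine ⟨by simpa using hv.1, ?_⟩
  rw [refl_map w hv.1]
  exact W.mul_mem (W.mul_mem hw hv.2) (W.inv_mem hw)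

theorem neg_mem_unitRoots {v : E} (hv : v ∈ unitRoots W) : -v ∈ unitRoots W := by
  refine ⟨by simpa using hv.1, ?_⟩
  have := refl_smul (neg_ne_zero.mpr one_ne_zero) v
  rw [neg_one_smul] at this
  rw [this]
  exact hv.2

theorem inner_ne_zero_of_mem_unitRoots (hx : x₀ ∈ mirrorCompl W) {v : E} (hv : v ∈ unitRoots W) :
    ⟪v, x₀⟫ ≠ 0 :=
  hx v (ne_zero_of_mem_unitRoots hv) hv.2

theorem pos_or_neg (hx : x₀ ∈ mirrorCompl W) {v : E} (hv : v ∈ unitRoots W) :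
    v ∈ posRoots W x₀ ∨ -v ∈ posRoots W x₀ := by
  rcases lt_or_gt_of_ne (inner_ne_zero_of_mem_unitRoots hx hv) with h | h
  · exact Or.inr ⟨neg_mem_unitRoots hv, by rw [inner_neg_left]; linarith⟩
  · exact Or.inl ⟨hv, h⟩

theorem not_pos_of_neg {v : E} (hv : v ∈ posRoots W x₀) : -v ∉ posRoots W x₀ := by
  intro h
  have := h.2
  rw [inner_neg_left] at this
  linarith [hv.2]

theorem eq_of_smul_pos {a b : E} (ha : a ∈ posRoots W x₀) (hb : b ∈ posRoots W x₀) {c : ℝ}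
    (h : b = c • a) : b = a := by
  have h1 : refl b = refl a := by
    rw [h]
    refine refl_smul ?_ a
    rintro rfl
    rw [zero_smul] at h
    exact ne_zero_of_mem_unitRoots hb.1 h
  rcases eq_or_eq_neg_of_refl_eq hb.1.1 ha.1.1 h1 with h2 | h2
  · exact h2
  · exact absurd (h2 ▸ hb) (not_pos_of_neg ha)

theorem mem_unitRoots_normalize {v : E} (hv : v ≠ 0) (hvW : refl v ∈ W) :
    ‖v‖⁻¹ • v ∈ unitRoots W := by
  refine ⟨norm_smul_inv_norm hv, ?_⟩
  rwa [refl_smul (inv_ne_zero (norm_ne_zero_iff.mpr hv))]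

theorem mem_chamber_iff (hx : x₀ ∈ mirrorCompl W) (y : E) :
    y ∈ chamber W x₀ ↔ ∀ v : E, refl v ∈ W → 0 ≤ ⟪v, x₀⟫ * ⟪v, y⟫ := by
  constructor
  · intro hy v hvW
    by_cases hv : v = 0
    · simp [hv]
    have h1 : ∀ z, ⟪v, z⟫ = ‖v‖ * ⟪‖v‖⁻¹ • v, z⟫ := by
      intro z
      rw [real_inner_smul_left, mul_inv_cancel_left₀ (norm_ne_zero_iff.mpr hv)]
    rw [h1 x₀, h1 y]
    have h2 : 0 ≤ ⟪‖v‖⁻¹ • v, x₀⟫ * ⟪‖v‖⁻¹ • v, y⟫ := by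
      rcases pos_or_neg hx (mem_unitRoots_normalize hv hvW) with h | h
      · exact mul_nonneg h.2.le (hy _ h)
      · have := mul_nonneg h.2.le (hy _ h)
        rwa [inner_neg_left, inner_neg_left, neg_mul_neg] at this
    have := mul_nonneg (mul_self_nonneg ‖v‖) h2
    linarith
  · intro hy v hv
    exact nonneg_of_mul_nonneg_right (hy v hv.1.2) hv.2

theorem exists_mem_chamber [Finite W] (x₀ y : E) :
    ∃ w ∈ W, w y ∈ chamber W x₀ ∧ ∀ w' ∈ W, ⟪x₀, w' y⟫ ≤ ⟪x₀, w y⟫ := by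
  obtain ⟨⟨w, hw⟩, h⟩ := Finite.exists_max (fun w : W => ⟪x₀, (w : E ≃ₗᵢ[ℝ] E) y⟫)
  have hmax : ∀ w' ∈ W, ⟪x₀, w' y⟫ ≤ ⟪x₀, w y⟫ := fun w' hw' => h ⟨w', hw'⟩
  refine ⟨w, hw, ?_, hmax⟩
  intro v hv
  have h1 := hmax (refl v * w) (W.mul_mem hv.1.2 hw)
  change ⟪x₀, refl v (w y)⟫ ≤ _ at h1
  rw [refl_apply_of_norm hv.1.1, inner_sub_right, real_inner_smul_right, real_inner_comm v x₀] at h1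
  have h2 := hv.2
  by_contra h3
  push Not at h3
  nlinarith [mul_neg_of_pos_of_neg h2 h3]

/-- Every positive root makes an acute angle with some simple root. -/
theorem exists_simple_inner_pos [Finite W] (hx : x₀ ∈ mirrorCompl W) {b : E} (hb : b ∈ posRoots W x₀) :
    ∃ a ∈ simpleRoots W x₀, 0 < ⟪a, b⟫ := by
  have hfin : (posRoots W x₀).Finite := finite_unitRoots.subset fun v hv => hv.1
  let cone : Set E → Submodule NNReal E := fun S => Submodule.span NNReal S
  obtain ⟨D, hD⟩ : ∃ D : Set E, Minimal (fun S => S ⊆ posRoots W x₀ ∧ posRoots W x₀ ⊆ cone S) D := by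
    have hf : {S | S ⊆ posRoots W x₀ ∧ posRoots W x₀ ⊆ cone S}.Finite :=
      hfin.finite_subsets.subset fun S hS => hS.1
    exact hf.exists_minimal ⟨_, subset_rfl, Submodule.subset_span⟩
  have hDP := hD.prop.1
  have hPD := hD.prop.2
  have hsimple : ∀ a ∈ D, a ∈ simpleRoots W x₀ := by
    intro a ha
    refine ⟨hDP ha, fun b hb hba => ?_⟩
    have hna : a ∉ cone (D \ {a}) := by
      intro hmem
      have hle : cone D ≤ cone (D \ {a}) := by
        refine Submodule.span_le.mpr fun d hd => ?_
        by_cases hda : d = a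
        · rw [hda]; exact hmem
        · exact Submodule.subset_span ⟨hd, hda⟩
      have := hD.le_of_le ⟨Set.sdiff_subset.trans hDP, fun p hp => hle (hPD hp)⟩ Set.sdiff_subset
      exact (this ha).2 rfl
    have hzero : ∀ z ∈ cone (D \ {a}), z = 0 ∨ 0 < ⟪z, x₀⟫ := by
      intro z hz
      induction hz using Submodule.span_induction with
      | mem z hz => exact Or.inr (hDP hz.1).2
      | zero => exact Or.inl rfl
      | add y z _ _ hy hz =>
        rcases hy with rfl | hy
        · simpa using hz
        · rcases hz with rfl | hz
          · simpa using Or.inr hy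
          · right; rw [inner_add_left]; linarith
      | smul c z _ hz =>
        rcases eq_or_ne c 0 with rfl | hc
        · simp
        rcases hz with rfl | hz
        · simp
        · right
          rw [NNReal.smul_def, real_inner_smul_left]
          exact mul_pos (NNReal.coe_pos.mpr (pos_iff_ne_zero.mpr hc)) hz
    have hdecomp : ∀ p ∈ posRoots W x₀, ∃ c : NNReal, ∃ z ∈ cone (D \ {a}), p = (c : ℝ) • a + z := by
      intro p hp
      have : p ∈ cone (insert a (D \ {a})) := by
        rw [Set.insert_sdiff_singleton, Set.insert_eq_of_mem ha]
        exact hPD hp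
      obtain ⟨c, z, hz, h⟩ := Submodule.mem_span_insert.mp this
      exact ⟨c, z, hz, h⟩
    by_contra hneg
    have hroot : refl a b ∈ unitRoots W := map_mem_unitRoots (hDP ha).1.2 hb.1
    have hd : -refl a b ∈ posRoots W x₀ := (pos_or_neg hx hroot).resolve_left hneg
    obtain ⟨s, y, hy, hby⟩ := hdecomp b hb
    obtain ⟨t, z, hz, hdz⟩ := hdecomp _ hd
    have hsum : y + z = (2 * ⟪a, b⟫ - s - t) • a := by
      have h1 : b + -refl a b = (2 * ⟪a, b⟫) • a := by
        rw [refl_apply_of_norm (hDP ha).1.1]; abel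
      rw [hdz] at h1
      nth_rw 1 [hby] at h1
      rw [sub_smul, sub_smul, ← h1]
      abel
    rcases lt_or_ge 0 (2 * ⟪a, b⟫ - s - t) with hc | hc
    · apply hna
      have h2 : (2 * ⟪a, b⟫ - s - t).toNNReal⁻¹ • (y + z) ∈ cone (D \ {a}) :=
        Submodule.smul_mem _ _ (Submodule.add_mem _ hy hz)
      rwa [NNReal.smul_def, hsum, smul_smul, NNReal.coe_inv, Real.coe_toNNReal _ hc.le,
        inv_mul_cancel₀ hc.ne', one_smul] at h2
    · have h1 := congrArg (fun u => ⟪u, x₀⟫) hsum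
      simp only [inner_add_left, real_inner_smul_left] at h1
      have h2 := mul_nonpos_of_nonpos_of_nonneg hc (hDP ha).2.le
      have hz0 : 0 ≤ ⟪z, x₀⟫ := by
        rcases hzero z hz with h | h
        · simp [h]
        · exact h.le
      have hy0 : y = 0 := by
        rcases hzero y hy with h | h
        · exact h
        · linarith
      rw [hy0, add_zero] at hby
      exact hba (eq_of_smul_pos (hDP ha) hb hby)
  by_contra! hneg
  have hcone : ∀ z ∈ cone D, ⟪z, b⟫ ≤ 0 := by
    intro z hz
    induction hz using Submodule.span_induction with
    | mem z hz => exact hneg z (hsimple z hz)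
    | zero => simp
    | add y z _ _ hy hz => rw [inner_add_left]; linarith
    | smul c z _ hz =>
      rw [NNReal.smul_def, real_inner_smul_left]
      exact mul_nonpos_of_nonneg_of_nonpos c.coe_nonneg hz
  have h1 := hcone b (hPD hb)
  rw [real_inner_self_eq_norm_sq, hb.1.1] at h1
  norm_num at h1

/-- The subgroup that is generated by the reflections in a set of vectors. -/
def reflGroup (S : Set E) : Subgroup (E ≃ₗᵢ[ℝ] E) := Subgroup.closure ((fun v => refl v) '' S)

theorem refl_mem_reflGroup {S : Set E} {v : E} (hv : v ∈ S) : refl v ∈ reflGroup S :=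
  Subgroup.subset_closure ⟨v, hv, rfl⟩

theorem reflGroup_mono {S T : Set E} (h : S ⊆ T) : reflGroup S ≤ reflGroup T :=
  Subgroup.closure_mono (Set.image_mono h)

theorem refl_mem_reflGroup_simple [Finite W] (hx : x₀ ∈ mirrorCompl W) {v : E}
    (hv : v ∈ posRoots W x₀) : refl v ∈ reflGroup (simpleRoots W x₀) := by
  have hfin : {b | b ∈ posRoots W x₀ ∧ ∃ g ∈ reflGroup (simpleRoots W x₀), b = g v}.Finite :=
    finite_unitRoots.subset fun b hb => hb.1.1
  obtain ⟨b, ⟨hb, g, hg, hbg⟩, hmin⟩ := hfin.exists_minimalFor (fun b => ⟪b, x₀⟫) _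
    ⟨v, hv, 1, one_mem _, rfl⟩
  obtain ⟨a, ha, hab⟩ := exists_simple_inner_pos hx hb
  have hba : b = a := by
    by_contra hne
    have h1 : refl a b ∈ posRoots W x₀ := ha.2 b hb hne
    have h2 := hmin ⟨h1, refl a * g, mul_mem (refl_mem_reflGroup ha) hg, by rw [hbg]; rfl⟩
    have h3 : ⟪refl a b, x₀⟫ = ⟪b, x₀⟫ - 2 * (⟪a, b⟫ * ⟪a, x₀⟫) := by
      rw [refl_apply_of_norm ha.1.1.1, inner_sub_left, real_inner_smul_left]; ring
    simp only [h3] at h2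
    have h4 := mul_pos hab ha.1.2
    have := h2 (by linarith)
    linarith
  have h5 : v = g⁻¹ a := by rw [← hba, hbg, inv_apply_self]
  rw [h5, refl_map _ ha.1.1.1]
  exact mul_mem (mul_mem (inv_mem hg) (refl_mem_reflGroup ha)) (inv_mem (inv_mem hg))

theorem le_reflGroup_simple (hW : IsFiniteReflectionGroup W) (hx : x₀ ∈ mirrorCompl W) :
    W ≤ reflGroup (simpleRoots W x₀) := by
  have := hW.finite
  obtain ⟨S, hS, hWS⟩ := hW.generated
  conv_lhs => rw [hWS]
  rw [Subgroup.closure_le]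
  intro s hs
  obtain ⟨v, hv, rfl⟩ := hS s hs
  have hvW : refl v ∈ W := by rw [hWS]; exact Subgroup.subset_closure hs
  have hu := mem_unitRoots_normalize hv hvW
  have hn : ‖v‖⁻¹ ≠ 0 := inv_ne_zero (norm_ne_zero_iff.mpr hv)
  rcases pos_or_neg hx hu with h | h
  · have := refl_mem_reflGroup_simple hx h
    rwa [refl_smul hn] at this
  · have := refl_mem_reflGroup_simple hx h
    rw [← neg_one_smul ℝ, refl_smul (neg_ne_zero.mpr one_ne_zero)] at this
    rwa [refl_smul hn] at this

/-- The product of the reflections in a list of vectors. -/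
def reflProd (l : List E) : E ≃ₗᵢ[ℝ] E := (l.map fun v => refl v).prod

theorem reflProd_cons (v : E) (l : List E) : reflProd (v :: l) = refl v * reflProd l := by
  simp [reflProd]

theorem reflProd_append (l m : List E) : reflProd (l ++ m) = reflProd l * reflProd m := by
  simp [reflProd]

theorem exists_reflProd_of_mem {S : Set E} {w : E ≃ₗᵢ[ℝ] E} (hw : w ∈ reflGroup S) :
    ∃ l : List E, (∀ v ∈ l, v ∈ S) ∧ reflProd l = w := by
  induction hw using Subgroup.closure_induction'' with
  | mem s hs => obtain ⟨v, hv, rfl⟩ := hs; exact ⟨[v], by simpa using hv, by simp [reflProd]⟩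
  | inv_mem s hs =>
    obtain ⟨v, hv, rfl⟩ := hs
    exact ⟨[v], by simpa using hv, by simp [reflProd]⟩
  | one => exact ⟨[], by simp, rfl⟩
  | mul x y _ _ hx hy =>
    obtain ⟨l, hl, rfl⟩ := hx
    obtain ⟨m, hm, rfl⟩ := hy
    refine ⟨l ++ m, fun v hv => ?_, reflProd_append l m⟩
    rcases List.mem_append.mp hv with h | h
    exacts [hl v h, hm v h]

/-- The exchange property. -/
theorem exists_reflProd_mul_refl {a : E} (ha : a ∈ simpleRoots W x₀)
    (l : List E) (hl : ∀ v ∈ l, v ∈ simpleRoots W x₀) (hneg : reflProd l a ∉ posRoots W x₀) :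
    ∃ m : List E, (∀ v ∈ m, v ∈ simpleRoots W x₀) ∧ m.length + 1 = l.length ∧
      reflProd m = reflProd l * refl a := by
  induction l with
  | nil => exact absurd ha.1 (by simpa [reflProd] using hneg)
  | cons b l ih =>
    have hl' : ∀ v ∈ l, v ∈ simpleRoots W x₀ := fun v hv => hl v (List.mem_cons_of_mem _ hv)
    have hb : b ∈ simpleRoots W x₀ := hl b List.mem_cons_self
    by_cases h : reflProd l a ∈ posRoots W x₀
    · have h1 : reflProd l a = b := by
        by_contra hne
        apply hneg
        rw [reflProd_cons]
        exact hb.2 _ h hne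
      refine ⟨l, hl', rfl, ?_⟩
      have h2 := refl_map (reflProd l) ha.1.1.1
      rw [h1] at h2
      rw [reflProd_cons, h2]
      simp [mul_assoc]
    · obtain ⟨m, hm, hlen, hprod⟩ := ih hl' h
      refine ⟨b :: m, ?_, by simp [hlen], by rw [reflProd_cons, reflProd_cons, hprod, mul_assoc]⟩
      intro v hv
      rcases List.mem_cons.mp hv with rfl | hv
      exacts [hb, hm v hv]

theorem mem_reflGroup_of_mem_chamber_of_reflProd {x : E}
    (hxC : x ∈ chamber W x₀) (n : ℕ) : ∀ l : List E, l.length = n →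
    (∀ v ∈ l, v ∈ simpleRoots W x₀) → reflProd l x ∈ chamber W x₀ →
      reflProd l ∈ reflGroup {a | a ∈ simpleRoots W x₀ ∧ ⟪a, x⟫ = 0} := by
  induction n using Nat.strong_induction_on with
  | _ n ih =>
    intro l hn hl hlx
    rcases List.eq_nil_or_concat l with rfl | ⟨m, a, rfl⟩
    · exact one_mem _
    rw [List.concat_eq_append] at *
    have ha : a ∈ simpleRoots W x₀ := hl a (by simp)
    have hm : ∀ v ∈ m, v ∈ simpleRoots W x₀ := fun v hv => hl v (by simp [hv])
    have hprod : reflProd (m ++ [a]) = reflProd m * refl a := by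
      rw [reflProd_append]; simp [reflProd]
    simp only [List.length_append, List.length_singleton] at hn
    by_cases hneg : reflProd m a ∈ posRoots W x₀
    · have h1 : 0 ≤ ⟪reflProd m a, reflProd m (refl a x)⟫ := by
        have := hlx _ hneg
        rwa [hprod] at this
      rw [(reflProd m).inner_map_map, ← inner_refl_left, refl_self, inner_neg_left] at h1
      have h2 : ⟪a, x⟫ = 0 := le_antisymm (by linarith) (hxC a ha.1)
      have h3 : reflProd (m ++ [a]) x = reflProd m x := by
        rw [hprod]
        change reflProd m (refl a x) = _
        rw [(refl_eq_self_iff a x).mpr h2]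
      rw [hprod]
      exact mul_mem (ih m.length (by omega) m rfl hm (h3 ▸ hlx))
        (refl_mem_reflGroup (S := {a | a ∈ simpleRoots W x₀ ∧ ⟪a, x⟫ = 0}) ⟨ha, h2⟩)
    · obtain ⟨m', hm', hlen, hm'p⟩ := exists_reflProd_mul_refl ha m hm hneg
      rw [hprod, ← hm'p] at hlx ⊢
      exact ih m'.length (by omega) m' rfl hm' hlx

theorem mem_reflGroup_of_mem_chamber (hW : IsFiniteReflectionGroup W) (hx : x₀ ∈ mirrorCompl W)
    {w : E ≃ₗᵢ[ℝ] E} (hw : w ∈ W) {x : E} (hxC : x ∈ chamber W x₀) (hwx : w x ∈ chamber W x₀) :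
    w ∈ reflGroup {a | a ∈ unitRoots W ∧ ⟪a, x⟫ = 0} := by
  obtain ⟨l, hl, rfl⟩ := exists_reflProd_of_mem (le_reflGroup_simple hW hx hw)
  refine reflGroup_mono ?_ (mem_reflGroup_of_mem_chamber_of_reflProd hxC l.length l rfl hl hwx)
  exact fun a ha => ⟨ha.1.1.1, ha.2⟩

theorem apply_eq_of_mem_reflGroup {S : Set E} {x : E} (hS : ∀ v ∈ S, ⟪v, x⟫ = 0)
    {w : E ≃ₗᵢ[ℝ] E} (hw : w ∈ reflGroup S) : w x = x := by
  obtain ⟨l, hl, rfl⟩ := exists_reflProd_of_mem hw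
  clear hw
  induction l with
  | nil => rfl
  | cons v l ih =>
    rw [reflProd_cons]
    change refl v (reflProd l x) = x
    rw [ih fun v hv => hl v (List.mem_cons_of_mem _ hv)]
    exact (refl_eq_self_iff v x).mpr (hS v (hl v List.mem_cons_self))

/-- The closed chamber contains at most one point of every orbit. -/
theorem eq_of_mem_chamber (hW : IsFiniteReflectionGroup W) (hx : x₀ ∈ mirrorCompl W)
    {w : E ≃ₗᵢ[ℝ] E} (hw : w ∈ W) {x : E} (hxC : x ∈ chamber W x₀) (hwx : w x ∈ chamber W x₀) :
    w x = x :=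
  apply_eq_of_mem_reflGroup (fun _ hv => hv.2) (mem_reflGroup_of_mem_chamber hW hx hw hxC hwx)

/-- Stabilizers of points are generated by reflections. -/
theorem mem_reflGroup_of_apply_eq (hW : IsFiniteReflectionGroup W) (hx : x₀ ∈ mirrorCompl W)
    {w : E ≃ₗᵢ[ℝ] E} (hw : w ∈ W) {x : E} (hwx : w x = x) :
    w ∈ reflGroup {a | a ∈ unitRoots W ∧ ⟪a, x⟫ = 0} := by
  have := hW.finite
  obtain ⟨g, hg, hgx, -⟩ := exists_mem_chamber (W := W) x₀ x
  have h1 : (g * w * g⁻¹) (g x) = g x := by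
    change g (w (g⁻¹ (g x))) = g x
    rw [inv_apply_self, hwx]
  have h2 := mem_reflGroup_of_mem_chamber hW hx
    (W.mul_mem (W.mul_mem hg hw) (W.inv_mem hg)) hgx (h1.symm ▸ hgx)
  obtain ⟨l, hl, hlw⟩ := exists_reflProd_of_mem h2
  have h3 : w = g⁻¹ * reflProd l * g := by rw [hlw]; group
  rw [h3]
  clear hlw h3 h1 h2
  induction l with
  | nil => simp [reflProd]
  | cons v l ih =>
    have hv := hl v List.mem_cons_self
    have h4 : g⁻¹ * reflProd (v :: l) * g = refl (g⁻¹ v) * (g⁻¹ * reflProd l * g) := by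
      rw [reflProd_cons, refl_map _ hv.1.1]; group
    rw [h4]
    refine mul_mem (refl_mem_reflGroup ⟨map_mem_unitRoots (W.inv_mem hg) hv.1, ?_⟩)
      (ih fun v hv => hl v (List.mem_cons_of_mem _ hv))
    rw [inner_isometry_left, inv_inv]
    exact hv.2

theorem eq_one_of_apply_eq (hW : IsFiniteReflectionGroup W) (hx : x₀ ∈ mirrorCompl W)
    {w : E ≃ₗᵢ[ℝ] E} (hw : w ∈ W) {x : E} (hreg : ∀ v ∈ unitRoots W, ⟪v, x⟫ ≠ 0)
    (hwx : w x = x) : w = 1 := by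
  have h := mem_reflGroup_of_apply_eq hW hx hw hwx
  have : {a | a ∈ unitRoots W ∧ ⟪a, x⟫ = 0} = ∅ := by
    ext a; simpa using fun ha => hreg a ha
  rw [this] at h
  simpa [reflGroup] using h

theorem mem_mirrorCompl_of_unitRoots {x : E} (hreg : ∀ v ∈ unitRoots W, ⟪v, x⟫ ≠ 0) :
    x ∈ mirrorCompl W := by
  intro v hv hvW h
  apply hreg _ (mem_unitRoots_normalize hv hvW)
  rw [real_inner_smul_left, h, mul_zero]

theorem posRoots_eq_of_mem_chamber (hx : x₀ ∈ mirrorCompl W) {x : E} (hxC : x ∈ chamber W x₀)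
    (hreg : ∀ v ∈ unitRoots W, ⟪v, x⟫ ≠ 0) : posRoots W x = posRoots W x₀ := by
  ext v
  constructor
  · rintro ⟨hv, hvx⟩
    refine (pos_or_neg hx hv).resolve_right fun h => ?_
    have := hxC _ h
    rw [inner_neg_left] at this
    linarith
  · intro hv
    exact ⟨hv.1, lt_of_le_of_ne (hxC v hv) (hreg v hv.1).symm⟩

theorem inner_apply_le_of_regular (hW : IsFiniteReflectionGroup W) (hx : x₀ ∈ mirrorCompl W)
    {x y : E} (hxC : x ∈ chamber W x₀) (hreg : ∀ v ∈ unitRoots W, ⟪v, x⟫ ≠ 0)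
    (hyC : y ∈ chamber W x₀) {w : E ≃ₗᵢ[ℝ] E} (hw : w ∈ W) :
    ⟪x, w y⟫ ≤ ⟪x, y⟫ ∧ (⟪x, w y⟫ = ⟪x, y⟫ → w y = y) := by
  have := hW.finite
  have hC : chamber W x = chamber W x₀ := by
    unfold chamber; rw [posRoots_eq_of_mem_chamber hx hxC hreg]
  have hxm := mem_mirrorCompl_of_unitRoots hreg
  have hmax : ∀ w ∈ W, ⟪x, w y⟫ ≤ ⟪x, y⟫ := by
    obtain ⟨g, hg, hgy, hmax⟩ := exists_mem_chamber (W := W) x y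
    rw [eq_of_mem_chamber hW hx hg hyC (hC ▸ hgy)] at hmax
    exact hmax
  refine ⟨hmax w hw, fun heq => eq_of_mem_chamber hW hx hw hyC ?_⟩
  rw [← hC]
  intro v hv
  have h1 := hmax (refl v * w) (W.mul_mem hv.1.2 hw)
  change ⟪x, refl v (w y)⟫ ≤ _ at h1
  rw [← heq, refl_apply_of_norm hv.1.1, inner_sub_right, real_inner_smul_right,
    real_inner_comm v x] at h1
  by_contra! h3
  nlinarith [mul_neg_of_pos_of_neg hv.2 h3]

theorem inner_apply_le (hW : IsFiniteReflectionGroup W) (hx : x₀ ∈ mirrorCompl W)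
    {x y : E} (hxC : x ∈ chamber W x₀) (hyC : y ∈ chamber W x₀) {w : E ≃ₗᵢ[ℝ] E} (hw : w ∈ W) :
    ⟪x, w y⟫ ≤ ⟪x, y⟫ := by
  have key : ∀ t : ℝ, 0 < t → ⟪x, w y⟫ + t * ⟪x₀, w y⟫ ≤ ⟪x, y⟫ + t * ⟪x₀, y⟫ := by
    intro t ht
    have hpos : ∀ v ∈ posRoots W x₀, 0 < ⟪v, x + t • x₀⟫ := by
      intro v hv
      rw [inner_add_right, real_inner_smul_right]
      have := hxC v hv
      have := mul_pos ht hv.2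
      linarith
    have := (inner_apply_le_of_regular hW hx (x := x + t • x₀) (fun v hv => (hpos v hv).le)
      (fun v hv => ?_) hyC hw).1
    · simpa only [inner_add_left, real_inner_smul_left] using this
    · rcases pos_or_neg hx hv with h | h
      · exact (hpos v h).ne'
      · have := hpos _ h
        rw [inner_neg_left] at this
        exact (by linarith : ⟪v, x + t • x₀⟫ < 0).ne
  have hlim : ∀ a b : ℝ, Filter.Tendsto (fun t : ℝ => a + t * b) (nhdsWithin 0 (Set.Ioi 0))
      (nhds a) := by
    intro a b
    have : Filter.Tendsto (fun t : ℝ => a + t * b) (nhds 0) (nhds (a + 0 * b)) :=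
      Continuous.tendsto (by fun_prop) 0
    rw [zero_mul, add_zero] at this
    exact this.mono_left nhdsWithin_le_nhds
  refine le_of_tendsto_of_tendsto (hlim ⟪x, w y⟫ ⟪x₀, w y⟫) (hlim ⟪x, y⟫ ⟪x₀, y⟫) ?_
  filter_upwards [self_mem_nhdsWithin] with t ht using key t ht

end Roots

section BallFraction

variable {E : Type*} [NormedAddCommGroup E] [InnerProductSpace ℝ E] [FiniteDimensional ℝ E]
  [MeasurableSpace E] [BorelSpace E]

open Classical in
/-- If almost every point lies in exactly `c` members of a finite family of sets, then the
ball fractions of the members add up to `c`. -/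
theorem sum_ballFraction_eq {ι : Type*} (s : Finset ι) (S : ι → Set E)
    (hS : ∀ i ∈ s, MeasurableSet (S i)) (c : ℕ)
    (h : ∀ᵐ x : E, (s.filter fun i => x ∈ S i).card = c) :
    ∑ i ∈ s, ballFraction (S i) = c := by
  set B : Set E := Metric.closedBall (0 : E) 1 with hB
  have hBfin : volume B ≠ ⊤ := measure_closedBall_lt_top.ne
  have hBpos : volume B ≠ 0 := (Metric.measure_closedBall_pos volume 0 one_pos).ne'
  have hsum : ∑ i ∈ s, volume (S i ∩ B) = c * volume B := by
    calc ∑ i ∈ s, volume (S i ∩ B)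
        = ∑ i ∈ s, ∫⁻ x in B, (S i).indicator 1 x := by
          refine Finset.sum_congr rfl fun i hi => ?_
          rw [lintegral_indicator_one (hS i hi), Measure.restrict_apply (hS i hi)]
      _ = ∫⁻ x in B, ∑ i ∈ s, (S i).indicator 1 x := by
          rw [lintegral_finsetSum]
          exact fun i hi => measurable_one.indicator (hS i hi)
      _ = ∫⁻ _ in B, (c : ENNReal) := by
          refine lintegral_congr_ae (ae_restrict_of_ae ?_)
          filter_upwards [h] with x hx
          rw [← hx]
          simp [Set.indicator_apply]
      _ = c * volume B := by rw [setLIntegral_const]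
  have hreal := congrArg ENNReal.toReal hsum
  rw [ENNReal.toReal_sum fun i _ => measure_ne_top_of_subset Set.inter_subset_right hBfin,
    ENNReal.toReal_mul, ENNReal.toReal_natCast] at hreal
  unfold ballFraction
  rw [← Finset.sum_div, hreal, mul_div_assoc, div_self, mul_one]
  exact ENNReal.toReal_ne_zero.mpr ⟨hBpos, hBfin⟩

variable {F : Type*} [NormedAddCommGroup F] [InnerProductSpace ℝ F] [FiniteDimensional ℝ F]
  [MeasurableSpace F] [BorelSpace F]

theorem ballFraction_preimage (f : E ≃ₗᵢ[ℝ] F) (S : Set F) :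
    ballFraction (f ⁻¹' S) = ballFraction S := by
  have hf : MeasurePreserving f.toMeasurableEquiv volume volume := f.measurePreserving
  have hball : f ⁻¹' Metric.closedBall (0 : F) 1 = Metric.closedBall (0 : E) 1 := by
    ext x; simp
  unfold ballFraction
  rw [← hball, ← Set.preimage_inter]
  congr 2
  · exact hf.measure_preimage_equiv _
  · exact hf.measure_preimage_equiv _

theorem ae_notMem_submodule {p : Submodule ℝ E} (hp : p ≠ ⊤) : ∀ᵐ x : E, x ∉ p := by
  have := Measure.addHaar_submodule (volume : Measure E) p hp
  exact measure_eq_zero_iff_ae_notMem.mp this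

end BallFraction

section DualCone

variable {E : Type*} [NormedAddCommGroup E] [InnerProductSpace ℝ E]

theorem exists_fixedPoint_of_nonexpansive {K : Set E} (hK : IsCompact K) (h0 : (0 : E) ∈ K)
    (hstar : ∀ x ∈ K, ∀ t : ℝ, 0 ≤ t → t ≤ 1 → t • x ∈ K) {f : E → E}
    (hf : ∀ x ∈ K, ∀ y ∈ K, dist (f x) (f y) ≤ dist x y) (hmaps : Set.MapsTo f K K) :
    ∃ x ∈ K, f x = x := by
  have happrox : ∀ t : ℝ, 0 ≤ t → t < 1 → ∃ x ∈ K, t • f x = x := by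
    intro t ht0 ht1
    have hm : Set.MapsTo (fun x => t • f x) K K := fun x hx => hstar _ (hmaps hx) t ht0 ht1.le
    have hc : ContractingWith t.toNNReal (hm.restrict (fun x => t • f x) K K) := by
      refine ⟨by rwa [Real.toNNReal_lt_one], LipschitzWith.of_dist_le_mul ?_⟩
      rintro ⟨x, hx⟩ ⟨y, hy⟩
      rw [Real.coe_toNNReal _ ht0, Subtype.dist_eq, Subtype.dist_eq]
      simp only [Set.MapsTo.val_restrict_apply]
      rw [dist_smul₀, Real.norm_of_nonneg ht0]
      exact mul_le_mul_of_nonneg_left (hf x hx y hy) ht0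
    obtain ⟨x, hx, hfix, -⟩ := ContractingWith.exists_fixedPoint' hK.isComplete hm hc h0
      (edist_ne_top _ _)
    exact ⟨x, hx, hfix⟩
  have hcont : ContinuousOn f K := by
    refine LipschitzOnWith.continuousOn (K := 1) (LipschitzOnWith.of_dist_le_mul ?_)
    simpa using hf
  obtain ⟨z, hz, hmin⟩ := hK.exists_isMinOn ⟨0, h0⟩ 
    (continuous_dist.comp_continuousOn (continuousOn_id.prodMk hcont))
  obtain ⟨R, hR0, hR⟩ := hK.isBounded.exists_pos_norm_le
  refine ⟨z, hz, ?_⟩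
  by_contra hne
  have hd : 0 < dist z (f z) := dist_pos.mpr (Ne.symm hne)
  have hq : 0 < dist z (f z) / (R + dist z (f z)) := by positivity
  have hq1 : dist z (f z) / (R + dist z (f z)) ≤ 1 := by
    rw [div_le_one (by positivity)]; linarith
  obtain ⟨x, hx, hfx⟩ := happrox (1 - dist z (f z) / (R + dist z (f z))) (by linarith)
    (by linarith)
  have h1 : dist z (f z) ≤ dist x (f x) := hmin hx
  have h2 : dist x (f x) = dist z (f z) / (R + dist z (f z)) * ‖f x‖ := by
    rw [dist_comm, dist_eq_norm]
    nth_rw 2 [← hfx]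
    rw [sub_smul, one_smul, sub_sub_cancel, norm_smul, Real.norm_of_nonneg hq.le]
  have h3 : dist z (f z) / (R + dist z (f z)) * ‖f x‖ ≤ dist z (f z) / (R + dist z (f z)) * R :=
    mul_le_mul_of_nonneg_left (hR _ (hmaps hx)) hq.le
  have h4 : dist z (f z) / (R + dist z (f z)) * R < dist z (f z) := by
    rw [div_mul_eq_mul_div, div_lt_iff₀ (by positivity)]
    nlinarith
  linarith

variable {W : Subgroup (E ≃ₗᵢ[ℝ] E)} {x₀ : E}

/-- The dual of the closed chamber that contains `x₀`. -/
def dualChamber (W : Subgroup (E ≃ₗᵢ[ℝ] E)) (x₀ : E) : Set E :=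
  {v | ∀ u ∈ chamber W x₀, 0 ≤ ⟪u, v⟫}

theorem isClosed_chamber : IsClosed (chamber W x₀) := by
  have : chamber W x₀ = ⋂ v ∈ posRoots W x₀, {y | 0 ≤ ⟪v, y⟫} := by ext; simp [chamber]
  rw [this]
  exact isClosed_biInter fun v _ => isClosed_le continuous_const (by fun_prop)

theorem isClosed_dualChamber : IsClosed (dualChamber W x₀) := by
  have : dualChamber W x₀ = ⋂ v ∈ chamber W x₀, {y | 0 ≤ ⟪v, y⟫} := by ext; simp [dualChamber]
  rw [this]
  exact isClosed_biInter fun v _ => isClosed_le continuous_const (by fun_prop)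

theorem convex_dualChamber : Convex ℝ (dualChamber W x₀) := by
  intro y hy z hz a b ha hb _ u hu
  rw [inner_add_right, real_inner_smul_right, real_inner_smul_right]
  exact add_nonneg (mul_nonneg ha (hy u hu)) (mul_nonneg hb (hz u hu))

theorem smul_mem_chamber {x : E} (hx : x ∈ chamber W x₀) {t : ℝ} (ht : 0 ≤ t) :
    t • x ∈ chamber W x₀ := by
  intro v hv
  rw [real_inner_smul_right]
  exact mul_nonneg ht (hx v hv)

theorem sub_apply_mem_dualChamber (hW : IsFiniteReflectionGroup W) (hx : x₀ ∈ mirrorCompl W)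
    {x : E} (hxC : x ∈ chamber W x₀) {w : E ≃ₗᵢ[ℝ] E} (hw : w ∈ W) :
    x - w x ∈ dualChamber W x₀ := by
  intro u hu
  rw [inner_sub_right]
  linarith [inner_apply_le hW hx hu hxC hw]

/-- Every interior point of the dual of the chamber has the form `x - w x`. -/
theorem exists_sub_apply_eq [FiniteDimensional ℝ E] (hW : IsFiniteReflectionGroup W)
    (hx : x₀ ∈ mirrorCompl W) {v : E} (hv : v ∈ interior (dualChamber W x₀)) :
    ∃ w ∈ W, ∃ x ∈ chamber W x₀, x - w x = v := by
  have := hW.finite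
  obtain ⟨e, he, hball⟩ := Metric.mem_nhds_iff.mp (mem_interior_iff_mem_nhds.mp hv)
  have hcoer : ∀ x ∈ chamber W x₀, e / 2 * ‖x‖ ≤ ⟪x, v⟫ := by
    intro x hxC
    rcases eq_or_ne x 0 with rfl | hne
    · simp
    have hn : 0 < ‖x‖ := norm_pos_iff.mpr hne
    have hmem : v - (e / 2 / ‖x‖) • x ∈ dualChamber W x₀ := by
      apply hball
      rw [Metric.mem_ball, dist_eq_norm, sub_sub_cancel_left, norm_neg, norm_smul,
        Real.norm_of_nonneg (by positivity), div_mul_cancel₀ _ hn.ne']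
      linarith
    have h1 := hmem x hxC
    rw [inner_sub_right, real_inner_smul_right, real_inner_self_eq_norm_sq] at h1
    have h2 : e / 2 / ‖x‖ * ‖x‖ ^ 2 = e / 2 * ‖x‖ := by field_simp
    linarith
  choose g hgW hgC _ using fun y => exists_mem_chamber (W := W) x₀ y
  have hnon : ∀ x y, dist (g x x) (g y y) ≤ dist x y := by
    intro x y
    have h1 : ⟪x, y⟫ ≤ ⟪g x x, g y y⟫ := by
      have := inner_apply_le hW hx (hgC x) (hgC y) (W.mul_mem (hgW x) (W.inv_mem (hgW y)))
      change ⟪g x x, g x ((g y)⁻¹ (g y y))⟫ ≤ _ at this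
      rwa [inv_apply_self, (g x).inner_map_map] at this
    rw [dist_eq_norm, dist_eq_norm, ← sq_le_sq₀ (norm_nonneg _) (norm_nonneg _),
      @norm_sub_sq_real, @norm_sub_sq_real, (g x).norm_map, (g y).norm_map]
    linarith
  set R : ℝ := ‖v‖ + ‖v‖ ^ 2 / e with hR
  have hR0 : 0 ≤ R := by positivity
  set K : Set E := chamber W x₀ ∩ Metric.closedBall 0 R
  have hKc : IsCompact K := (isCompact_closedBall 0 R).inter_left isClosed_chamber
  obtain ⟨x, hxK, hfix⟩ := exists_fixedPoint_of_nonexpansive (f := fun x => g (x - v) (x - v)) hKc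
    ⟨fun v _ => by simp, by simpa using hR0⟩
    (fun x hxK t ht0 ht1 => ⟨smul_mem_chamber hxK.1 ht0, by
      have h2 : ‖x‖ ≤ R := by simpa using hxK.2
      rw [mem_closedBall_zero_iff, norm_smul, Real.norm_of_nonneg ht0]
      nlinarith [norm_nonneg x]⟩)
    (fun x _ y _ => by simpa using hnon (x - v) (y - v))
    (fun x hxK => ⟨hgC _, by
      have h2 : ‖x‖ ≤ R := by simpa using hxK.2
      rw [mem_closedBall_zero_iff, (g _).norm_map]
      rcases le_or_gt ‖x‖ (‖v‖ ^ 2 / e) with h | h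
      · exact (norm_sub_le x v).trans (by linarith)
      · refine le_trans ?_ h2
        rw [← sq_le_sq₀ (norm_nonneg _) (norm_nonneg _), @norm_sub_sq_real]
        have h3 := hcoer x hxK.1
        rw [div_lt_iff₀ he] at h
        linarith⟩)
  refine ⟨(g (x - v))⁻¹, W.inv_mem (hgW _), x, hxK.1, ?_⟩
  have h4 : (g (x - v))⁻¹ x = x - v := by
    nth_rw 2 [← hfix]
    exact inv_apply_self _ _
  rw [h4, sub_sub_cancel]

theorem mem_fixedSpace {w : E ≃ₗᵢ[ℝ] E} {x : E} : x ∈ fixedSpace w ↔ w x = x := by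
  unfold fixedSpace
  rw [LinearMap.mem_ker, LinearMap.sub_apply, sub_eq_zero, eq_comm]
  rfl

theorem fixedSpace_conj_eq_bot {w g : E ≃ₗᵢ[ℝ] E} (h : fixedSpace w = ⊥) :
    fixedSpace (g * w * g⁻¹) = ⊥ := by
  rw [Submodule.eq_bot_iff] at h ⊢
  intro x hx
  have h1 : g (w (g⁻¹ x)) = x := mem_fixedSpace.mp hx
  have h2 := h (g⁻¹ x) (mem_fixedSpace.mpr (by nth_rw 2 [← h1]; rw [inv_apply_self]))
  simpa [apply_inv_self] using congrArg g h2

theorem eq_and_eq_of_sub_apply_eq (hW : IsFiniteReflectionGroup W) (hx : x₀ ∈ mirrorCompl W)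
    {x y : E} (hxC : x ∈ chamber W x₀) (hreg : ∀ a ∈ unitRoots W, ⟪a, x⟫ ≠ 0)
    (hyC : y ∈ chamber W x₀) {w w' : E ≃ₗᵢ[ℝ] E} (hw : w ∈ W) (hw' : w' ∈ W)
    (hfix : fixedSpace w = ⊥) (h : x - w x = y - w' y) : w = w' ∧ x = y := by
  have h1 : w x - w' y = x - y := by
    rw [sub_eq_sub_iff_add_eq_add] at h ⊢
    rw [add_comm, ← h]
  have h2 : ⟪w x, w' y⟫ = ⟪x, y⟫ := by
    have := congrArg (fun z => ‖z‖ ^ 2) h1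
    simp only [@norm_sub_sq_real, LinearIsometryEquiv.norm_map] at this
    linarith
  rw [inner_isometry_left] at h2
  have hww : w⁻¹ * w' ∈ W := W.mul_mem (W.inv_mem hw) hw'
  have h3 : w⁻¹ (w' y) = y := (inner_apply_le_of_regular hW hx hxC hreg hyC hww).2 h2
  have h4 : w' y = w y := by rw [← apply_inv_self w (w' y), h3]
  have h5 : x = y := by
    rw [h4, ← map_sub] at h1
    have := (Submodule.eq_bot_iff _).mp hfix _ (mem_fixedSpace.mpr h1)
    exact sub_eq_zero.mp this
  subst h5
  exact ⟨inv_mul_eq_one.mp (eq_one_of_apply_eq hW hx hww hreg h3), rfl⟩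

/-- The points that are not of the form `x - w x` with `w` singular or `x` on a mirror. -/
def IsGenericPoint (W : Subgroup (E ≃ₗᵢ[ℝ] E)) (v : E) : Prop :=
  ∀ w ∈ W, ∀ x, x - w x = v → fixedSpace w = ⊥ ∧ ∀ a ∈ unitRoots W, ⟪a, x⟫ ≠ 0

theorem IsGenericPoint.map {v : E} (hv : IsGenericPoint W v) {g : E ≃ₗᵢ[ℝ] E} (hg : g ∈ W) :
    IsGenericPoint W (g v) := by
  intro w hw x hxv
  have h1 : g⁻¹ x - (g⁻¹ * w * g) (g⁻¹ x) = v := by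
    change g⁻¹ x - g⁻¹ (w (g (g⁻¹ x))) = v
    rw [apply_inv_self, ← map_sub, hxv, inv_apply_self]
  obtain ⟨h2, h3⟩ := hv _ (W.mul_mem (W.mul_mem (W.inv_mem hg) hw) hg) _ h1
  constructor
  · have := fixedSpace_conj_eq_bot (g := g) h2
    rwa [show g * (g⁻¹ * w * g) * g⁻¹ = w by group] at this
  · intro a ha h
    apply h3 _ (map_mem_unitRoots (W.inv_mem hg) ha)
    rw [(g⁻¹).inner_map_map, h]

theorem orthogonal_singleton_ne_top {a : E} (ha : a ≠ 0) : (ℝ ∙ a)ᗮ ≠ ⊤ := by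
  intro h
  have : a ∈ (ℝ ∙ a)ᗮ := h ▸ Submodule.mem_top
  rw [Submodule.mem_orthogonal_singleton_iff_inner_right] at this
  exact ha (inner_self_eq_zero.mp this)

variable [FiniteDimensional ℝ E]

open Classical in
theorem card_apply_mem_dualChamber [Fintype W] (hW : IsFiniteReflectionGroup W)
    (hx : x₀ ∈ mirrorCompl W) {v : E} (hv : IsGenericPoint W v)
    (hfr : ∀ g ∈ W, g v ∉ frontier (dualChamber W x₀)) :
    (Finset.univ.filter fun g : W => (g : E ≃ₗᵢ[ℝ] E) v ∈ dualChamber W x₀).card =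
      (Finset.univ.filter fun w : W => fixedSpace (w : E ≃ₗᵢ[ℝ] E) = ⊥).card := by
  have key := Finset.card_mul_eq_card_mul
    (s := Finset.univ.filter fun g : W => (g : E ≃ₗᵢ[ℝ] E) v ∈ dualChamber W x₀)
    (t := Finset.univ.filter fun w : W => fixedSpace (w : E ≃ₗᵢ[ℝ] E) = ⊥)
    (m := 1) (n := 1)
    (fun g w : W => ∃ x ∈ chamber W x₀,
      x - ((g * w * g⁻¹ : W) : E ≃ₗᵢ[ℝ] E) x = (g : E ≃ₗᵢ[ℝ] E) v) ?_ ?_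
  · simpa using key
  · intro g hg
    rw [Finset.mem_filter] at hg
    have hint : (g : E ≃ₗᵢ[ℝ] E) v ∈ interior (dualChamber W x₀) := by
      by_contra h
      exact hfr g g.2 ⟨subset_closure hg.2, h⟩
    obtain ⟨u, hu, x, hxC, hux⟩ := exists_sub_apply_eq hW hx hint
    obtain ⟨hufix, hxreg⟩ := hv.map g.2 u hu x hux
    refine Finset.card_eq_one.mpr ⟨g⁻¹ * ⟨u, hu⟩ * g, ?_⟩
    ext w
    rw [Finset.mem_bipartiteAbove, Finset.mem_singleton]
    constructor
    · rintro ⟨-, y, hyC, hwy⟩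
      have := (eq_and_eq_of_sub_apply_eq hW hx hxC hxreg hyC hu (g * w * g⁻¹ : W).2 hufix
        (hux.trans hwy.symm)).1
      have h2 : (⟨u, hu⟩ : W) = g * w * g⁻¹ := Subtype.ext this
      rw [h2]; group
    · rintro rfl
      refine ⟨?_, x, hxC, ?_⟩
      · rw [Finset.mem_filter]
        refine ⟨Finset.mem_univ _, ?_⟩
        have := fixedSpace_conj_eq_bot (g := (g : E ≃ₗᵢ[ℝ] E)⁻¹) hufix
        rwa [inv_inv] at this
      · rw [show g * (g⁻¹ * ⟨u, hu⟩ * g) * g⁻¹ = ⟨u, hu⟩ by group]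
        exact hux
  · intro w hw
    rw [Finset.mem_filter] at hw
    have hinj := hw.2
    have hsurj : ∃ y, y - (w : E ≃ₗᵢ[ℝ] E) y = v :=
      LinearMap.range_eq_top.mp (LinearMap.ker_eq_bot_iff_range_eq_top.mp hinj) v
    obtain ⟨y, hy⟩ := hsurj
    have hyuniq : ∀ z, z - (w : E ≃ₗᵢ[ℝ] E) z = v → z = y := fun z hz =>
      LinearMap.ker_eq_bot.mp hinj (hz.trans hy.symm)
    have hyreg := (hv w w.2 y hy).2
    obtain ⟨g, hg, hgy, -⟩ := exists_mem_chamber (W := W) x₀ y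
    have hgx : g y - ((⟨g, hg⟩ * w * ⟨g, hg⟩⁻¹ : W) : E ≃ₗᵢ[ℝ] E) (g y) = g v := by
      change g y - g ((w : E ≃ₗᵢ[ℝ] E) (g⁻¹ (g y))) = g v
      rw [inv_apply_self, ← map_sub, hy]
    refine Finset.card_eq_one.mpr ⟨⟨g, hg⟩, ?_⟩
    ext h
    rw [Finset.mem_bipartiteBelow, Finset.mem_singleton]
    constructor
    · rintro ⟨-, x, hxC, hxv⟩
      have h1 : (h : E ≃ₗᵢ[ℝ] E)⁻¹ x = y := by
        apply hyuniq
        have := congrArg (fun z => (h : E ≃ₗᵢ[ℝ] E)⁻¹ z) hxv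
        simp only [map_sub, inv_apply_self] at this
        change _ - (h : E ≃ₗᵢ[ℝ] E)⁻¹ ((h : E ≃ₗᵢ[ℝ] E) (w.1 ((h : E ≃ₗᵢ[ℝ] E)⁻¹ x))) = v at this
        rwa [inv_apply_self] at this
      have h2 : x = (h : E ≃ₗᵢ[ℝ] E) y := by rw [← h1, apply_inv_self]
      have hhg : (h : E ≃ₗᵢ[ℝ] E) * g⁻¹ ∈ W := W.mul_mem h.2 (W.inv_mem hg)
      have h3 : ((h : E ≃ₗᵢ[ℝ] E) * g⁻¹) (g y) = x := by
        change (h : E ≃ₗᵢ[ℝ] E) (g⁻¹ (g y)) = x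
        rw [inv_apply_self, h2]
      have h4 := eq_of_mem_chamber hW hx hhg hgy (h3.symm ▸ hxC)
      have h5 := eq_one_of_apply_eq hW hx hhg (fun a ha h0 => by
        rw [real_inner_comm, inner_isometry_left, real_inner_comm] at h0
        exact hyreg _ (map_mem_unitRoots (W.inv_mem hg) ha) h0) h4
      exact Subtype.ext (mul_inv_eq_one.mp h5)
    · rintro rfl
      refine ⟨Finset.mem_filter.mpr ⟨Finset.mem_univ _, ?_⟩, g y, hgy, hgx⟩
      change g v ∈ _
      rw [← hgx]
      exact sub_apply_mem_dualChamber hW hx hgy (⟨g, hg⟩ * w * ⟨g, hg⟩⁻¹ : W).2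

variable [MeasurableSpace E] [BorelSpace E]

theorem ae_isGenericPoint [Finite W] : ∀ᵐ v : E, IsGenericPoint W v := by
  have hR : Countable (unitRoots W) := (finite_unitRoots (W := W)).countable
  have h1 : ∀ᵐ v : E, ∀ w : W, fixedSpace (w : E ≃ₗᵢ[ℝ] E) ≠ ⊥ →
      v ∉ LinearMap.range (LinearMap.id - ((w : E ≃ₗᵢ[ℝ] E).toLinearEquiv : E →ₗ[ℝ] E)) := by
    rw [ae_all_iff]
    intro w
    by_cases hw : fixedSpace (w : E ≃ₗᵢ[ℝ] E) = ⊥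
    · simp [hw]
    · filter_upwards [ae_notMem_submodule (fun h => hw
        (LinearMap.ker_eq_bot_iff_range_eq_top.mpr h))] with v hv _ using hv
  have h2 : ∀ᵐ v : E, ∀ w : W, ∀ a : unitRoots W, v ∉ Submodule.map
      (LinearMap.id - ((w : E ≃ₗᵢ[ℝ] E).toLinearEquiv : E →ₗ[ℝ] E)) (ℝ ∙ (a : E))ᗮ := by
    rw [ae_all_iff]
    intro w
    rw [ae_all_iff]
    intro a
    refine ae_notMem_submodule fun h => ?_
    have hle := Submodule.finrank_map_le
      (LinearMap.id - ((w : E ≃ₗᵢ[ℝ] E).toLinearEquiv : E →ₗ[ℝ] E)) (ℝ ∙ (a : E))ᗮ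
    rw [h, finrank_top] at hle
    have hlt := Submodule.finrank_lt
      (orthogonal_singleton_ne_top (ne_zero_of_mem_unitRoots a.2))
    omega
  filter_upwards [h1, h2] with v hv1 hv2 w hw x hx
  constructor
  · by_contra h
    exact hv1 ⟨w, hw⟩ h ⟨x, hx⟩
  · intro a ha h
    exact hv2 ⟨w, hw⟩ ⟨a, ha⟩
      ⟨x, (Submodule.mem_orthogonal_singleton_iff_inner_right).mpr h, hx⟩

/-- The angle measure of the dual of a chamber. -/
theorem card_mul_ballFraction_dualChamber (hW : IsFiniteReflectionGroup W)
    (hx : x₀ ∈ mirrorCompl W) :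
    Nat.card W * ballFraction (dualChamber W x₀) =
      Nat.card {w : W | fixedSpace (w : E ≃ₗᵢ[ℝ] E) = ⊥} := by
  classical
  have := hW.finite
  have := Fintype.ofFinite W
  have hfr : ∀ᵐ v : E, ∀ g : W, (g : E ≃ₗᵢ[ℝ] E) v ∉ frontier (dualChamber W x₀) := by
    rw [ae_all_iff]
    intro g
    exact (g : E ≃ₗᵢ[ℝ] E).measurePreserving.quasiMeasurePreserving.ae
      (measure_eq_zero_iff_ae_notMem.mp (convex_dualChamber.addHaar_frontier volume))
  have h := sum_ballFraction_eq (Finset.univ : Finset W)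
    (fun g => (g : E ≃ₗᵢ[ℝ] E) ⁻¹' dualChamber W x₀)
    (fun g _ => (isClosed_dualChamber.preimage (g : E ≃ₗᵢ[ℝ] E).continuous).measurableSet)
    (Finset.univ.filter fun w : W => fixedSpace (w : E ≃ₗᵢ[ℝ] E) = ⊥).card (by
      filter_upwards [ae_isGenericPoint (W := W), hfr] with v hv1 hv2
      exact card_apply_mem_dualChamber hW hx hv1 fun g hg => hv2 ⟨g, hg⟩)
  simp only [ballFraction_preimage, Finset.sum_const, nsmul_eq_mul, Finset.card_univ] at h
  rw [Nat.card_eq_fintype_card, h, Nat.card_eq_fintype_card, ← Fintype.card_subtype]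
  rfl

end DualCone

section Faces

variable {E : Type*} [NormedAddCommGroup E] [InnerProductSpace ℝ E]
  {W : Subgroup (E ≃ₗᵢ[ℝ] E)} {x₀ : E} {C F : PointedCone ℝ E}

theorem mem_image_iff {w : E ≃ₗᵢ[ℝ] E} {U : Submodule ℝ E} {x : E} :
    x ∈ image w U ↔ w⁻¹ x ∈ U := by
  constructor
  · rintro ⟨y, hy, rfl⟩
    exact (inv_apply_self w y).symm ▸ hy
  · exact fun h => ⟨w⁻¹ x, h, apply_inv_self w x⟩

theorem apply_mem_image {w : E ≃ₗᵢ[ℝ] E} {U : Submodule ℝ E} {x : E} (hx : x ∈ U) :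
    w x ∈ image w U :=
  ⟨x, hx, rfl⟩

theorem image_mul (a b : E ≃ₗᵢ[ℝ] E) (U : Submodule ℝ E) :
    image (a * b) U = image a (image b U) :=
  Submodule.map_comp _ _ U

theorem image_one (U : Submodule ℝ E) : image 1 U = U := Submodule.map_id U

theorem image_inv_of_eq {w : E ≃ₗᵢ[ℝ] E} {U U' : Submodule ℝ E} (h : image w U = U') :
    image w⁻¹ U' = U := by
  rw [← h, ← image_mul, inv_mul_cancel, image_one]

theorem image_eq_of_mem_pointFixer {U : Submodule ℝ E} {w : E ≃ₗᵢ[ℝ] E}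
    (hw : w ∈ pointFixer W U) : image w U = U := by
  ext x
  rw [mem_image_iff]
  constructor
  · intro h
    have := hw.2 _ h
    rw [apply_inv_self] at this
    rwa [this]
  · intro h
    rwa [((pointFixer W U).inv_mem hw).2 x h]

/-- The intersection of the mirrors of `W` that contain `S`. -/
def mirrorHull (W : Subgroup (E ≃ₗᵢ[ℝ] E)) (S : Set E) : Submodule ℝ E where
  carrier := {y | ∀ v ∈ unitRoots W, (∀ u ∈ S, ⟪v, u⟫ = 0) → ⟪v, y⟫ = 0}
  zero_mem' := fun v _ _ => inner_zero_right v
  add_mem' := fun {a b} ha hb v hv h => by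
    rw [inner_add_right, ha v hv h, hb v hv h, add_zero]
  smul_mem' := fun c a ha v hv h => by rw [real_inner_smul_right, ha v hv h, mul_zero]

theorem subset_mirrorHull (S : Set E) : S ⊆ mirrorHull W S := fun _ hy _ _ h => h _ hy

theorem mirrorHull_eq_of_forall {S T : Set E}
    (h : ∀ v ∈ unitRoots W, (∀ u ∈ S, ⟪v, u⟫ = 0) ↔ ∀ u ∈ T, ⟪v, u⟫ = 0) :
    mirrorHull W S = mirrorHull W T := by
  ext y
  exact forall₂_congr fun v hv => by rw [h v hv]

theorem image_mirrorHull {w : E ≃ₗᵢ[ℝ] E} (hw : w ∈ W) (x : E) :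
    image w (mirrorHull W {x}) = mirrorHull W {w x} := by
  ext y
  rw [mem_image_iff]
  constructor
  · intro h v hv hvx
    have := h _ (map_mem_unitRoots (W.inv_mem hw) hv) (by
      simpa [inner_isometry_left] using hvx)
    rwa [(w⁻¹).inner_map_map] at this
  · intro h v hv hvx
    have := h _ (map_mem_unitRoots hw hv) (by simpa using hvx)
    rwa [inner_isometry_left] at this

/-- `u` is a point of `U` that lies only on those mirrors that contain `U`. -/
def IsGenericIn (W : Subgroup (E ≃ₗᵢ[ℝ] E)) (U : Submodule ℝ E) (u : E) : Prop :=
  u ∈ U ∧ ∀ v ∈ unitRoots W, ⟪v, u⟫ = 0 → ∀ z ∈ U, ⟪v, z⟫ = 0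

theorem IsGenericIn.mirrorHull_eq {U : Submodule ℝ E} {u : E} (hu : IsGenericIn W U u) :
    mirrorHull W {u} = mirrorHull W U :=
  mirrorHull_eq_of_forall fun v hv =>
    ⟨fun h => hu.2 v hv (h u rfl), fun h _ hz => (Set.mem_singleton_iff.mp hz) ▸ h u hu.1⟩

theorem IsGenericIn.mem_pointFixer {U : Submodule ℝ E} {u : E} (hu : IsGenericIn W U u)
    (hW : IsFiniteReflectionGroup W) (hx : x₀ ∈ mirrorCompl W) {w : E ≃ₗᵢ[ℝ] E} (hw : w ∈ W)
    (hwu : w u = u) : w ∈ pointFixer W U := by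
  refine ⟨hw, fun z hz => ?_⟩
  exact apply_eq_of_mem_reflGroup (fun v hv => hu.2 v hv.1 hv.2 z hz)
    (mem_reflGroup_of_apply_eq hW hx hw hwu)

theorem IsGenericIn.mirrorHull_fixedSpace {w : E ≃ₗᵢ[ℝ] E} {u : E}
    (hu : IsGenericIn W (fixedSpace w) u) (hW : IsFiniteReflectionGroup W)
    (hx : x₀ ∈ mirrorCompl W) (hw : w ∈ W) :
    mirrorHull W (fixedSpace w) = fixedSpace w := by
  refine le_antisymm (fun z hz => ?_) (subset_mirrorHull _)
  rw [mem_fixedSpace]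
  exact apply_eq_of_mem_reflGroup (fun v hv => hz v hv.1 (hu.2 v hv.1 hv.2))
    (mem_reflGroup_of_apply_eq hW hx hw (mem_fixedSpace.mp hu.1))

theorem forall_unitRoots_of_posRoots (hx : x₀ ∈ mirrorCompl W) {p q : E}
    (h : ∀ v ∈ posRoots W x₀, ⟪v, p⟫ = 0 → ⟪v, q⟫ = 0) {v : E} (hv : v ∈ unitRoots W)
    (hvp : ⟪v, p⟫ = 0) : ⟪v, q⟫ = 0 := by
  rcases pos_or_neg hx hv with h1 | h1
  · exact h v h1 hvp
  · simpa using h _ h1 (by simpa using hvp)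

theorem exists_isGenericIn_face [Finite W] (hx : x₀ ∈ mirrorCompl W)
    (hC : ∀ y, y ∈ C ↔ y ∈ chamber W x₀) (hF : F.IsFaceOf C) :
    ∃ p ∈ F, IsGenericIn W (linSpan F) p := by
  classical
  have hfin : (posRoots W x₀).Finite := finite_unitRoots.subset fun v hv => hv.1
  have hch : ∀ v : E, ∃ f ∈ F, ⟪v, f⟫ = 0 → ∀ u ∈ F, ⟪v, u⟫ = 0 := by
    intro v
    by_cases h : ∀ u ∈ F, ⟪v, u⟫ = 0
    · exact ⟨0, F.zero_mem, fun _ => h⟩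
    · push Not at h
      obtain ⟨u, hu, hvu⟩ := h
      exact ⟨u, hu, fun h => absurd h hvu⟩
  choose f hfF hf using hch
  have hpF : ∑ b ∈ hfin.toFinset, f b ∈ F := Submodule.sum_mem _ fun b _ => hfF b
  refine ⟨_, hpF, Submodule.subset_span hpF, fun v hv hvp => ?_⟩
  have key : ∀ u ∈ F, ⟪v, u⟫ = 0 := by
    intro u hu
    refine forall_unitRoots_of_posRoots hx (fun v hv hvp => ?_) hv hvp
    rw [inner_sum, Finset.sum_eq_zero_iff_of_nonneg
      fun b _ => (hC _).mp (hF.le (hfF b)) v hv] at hvp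
    exact hf v (hvp v (hfin.mem_toFinset.mpr hv)) u hu
  intro z hz
  induction hz using Submodule.span_induction with
  | mem u hu => exact key u hu
  | zero => exact inner_zero_right v
  | add a b _ _ ha hb => rw [inner_add_right, ha, hb, add_zero]
  | smul c a _ ha => rw [real_inner_smul_right, ha, mul_zero]

theorem exists_abs_inner_le [Finite W] {p : E} (hp : p ∈ chamber W x₀) (z : E) :
    ∃ N : ℝ, 0 ≤ N ∧ ∀ v ∈ posRoots W x₀, ⟪v, p⟫ ≠ 0 → |⟪v, z⟫| ≤ N * ⟪v, p⟫ := by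
  have hfin : (posRoots W x₀).Finite := finite_unitRoots.subset fun v hv => hv.1
  have hnn : ∀ v ∈ hfin.toFinset, 0 ≤ |⟪v, z⟫| / ⟪v, p⟫ := fun v hv =>
    div_nonneg (abs_nonneg _) (hp v (hfin.mem_toFinset.mp hv))
  refine ⟨∑ v ∈ hfin.toFinset, |⟪v, z⟫| / ⟪v, p⟫, Finset.sum_nonneg hnn, fun v hv hvp => ?_⟩
  have h1 := Finset.single_le_sum hnn (hfin.mem_toFinset.mpr hv)
  rwa [div_le_iff₀ (lt_of_le_of_ne (hp v hv) hvp.symm)] at h1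

theorem exists_smul_add_mem_chamber [Finite W] {p z : E} (hp : p ∈ chamber W x₀)
    (hz : ∀ v ∈ posRoots W x₀, ⟪v, p⟫ = 0 → 0 ≤ ⟪v, z⟫) :
    ∃ N : ℝ, 0 ≤ N ∧ ∀ M, N ≤ M → M • p + z ∈ chamber W x₀ := by
  obtain ⟨N, hN, h⟩ := exists_abs_inner_le hp z
  refine ⟨N, hN, fun M hM v hv => ?_⟩
  rw [inner_add_right, real_inner_smul_right]
  by_cases hvp : ⟪v, p⟫ = 0
  · rw [hvp, mul_zero, zero_add]
    exact hz v hv hvp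
  · have h1 := h v hv hvp
    have h2 := mul_le_mul_of_nonneg_right hM (hp v hv)
    linarith [neg_abs_le ⟪v, z⟫]

theorem linSpan_face [Finite W] (hx : x₀ ∈ mirrorCompl W)
    (hC : ∀ y, y ∈ C ↔ y ∈ chamber W x₀) (hF : F.IsFaceOf C) :
    linSpan F = mirrorHull W (linSpan F) ∧ ∀ y, y ∈ F ↔ y ∈ C ∧ y ∈ linSpan F := by
  obtain ⟨p, hpF, hp⟩ := exists_isGenericIn_face hx hC hF
  have hpC := (hC p).mp (hF.le hpF)
  have hkey : ∀ z ∈ mirrorHull W (linSpan F), ∃ N : ℝ, 0 ≤ N ∧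
      N • p + z ∈ C ∧ N • p + -z ∈ C := by
    intro z hz
    have hz0 : ∀ v ∈ posRoots W x₀, ⟪v, p⟫ = 0 → ⟪v, z⟫ = 0 := fun v hv hvp =>
      hz v hv.1 (hp.2 v hv.1 hvp)
    obtain ⟨N, hN, h1⟩ := exists_smul_add_mem_chamber (z := z) hpC fun v hv hvp =>
      (hz0 v hv hvp).ge
    obtain ⟨M, hM, h2⟩ := exists_smul_add_mem_chamber (z := -z) hpC fun v hv hvp => by
      rw [inner_neg_right, hz0 v hv hvp, neg_zero]
    exact ⟨max N M, le_max_of_le_left hN, (hC _).mpr (h1 _ (le_max_left _ _)),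
      (hC _).mpr (h2 _ (le_max_right _ _))⟩
  refine ⟨le_antisymm (subset_mirrorHull _) fun z hz => ?_, fun y => ⟨fun hy =>
    ⟨hF.le hy, Submodule.subset_span hy⟩, ?_⟩⟩
  · obtain ⟨N, hN, h1, h2⟩ := hkey z hz
    have h3 : N • p ∈ F := PointedCone.smul_mem _ hN hpF
    have h4 : N • p + z ∈ F := by
      refine hF.mem_of_add_mem_left h1 h2 ?_
      have : N • p + z + (N • p + -z) = N • p + N • p := by abel
      rw [this]
      exact F.add_mem h3 h3
    have h5 := Submodule.sub_mem (linSpan F) (Submodule.subset_span h4) (Submodule.subset_span h3)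
    rwa [add_sub_cancel_left] at h5
  · rintro ⟨hyC, hy⟩
    obtain ⟨N, hN, -, h2⟩ := hkey y (subset_mirrorHull _ hy)
    refine hF.mem_of_add_mem_left hyC h2 ?_
    have : y + (N • p + -y) = N • p := by abel
    rw [this]
    exact PointedCone.smul_mem _ hN hpF

theorem face_ext [Finite W] (hx : x₀ ∈ mirrorCompl W) (hC : ∀ y, y ∈ C ↔ y ∈ chamber W x₀)
    {F' : PointedCone ℝ E} (hF : F.IsFaceOf C) (hF' : F'.IsFaceOf C)
    (h : linSpan F = linSpan F') : F = F' := by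
  ext y
  rw [(linSpan_face hx hC hF).2, (linSpan_face hx hC hF').2, h]

theorem finite_faces [Finite W] (hx : x₀ ∈ mirrorCompl W) (hC : ∀ y, y ∈ C ↔ y ∈ chamber W x₀)
    (k : ℕ) : (faces C k).Finite := by
  refine Set.Finite.of_injOn (f := fun F => {v ∈ unitRoots W | ∀ u ∈ linSpan F, ⟪v, u⟫ = 0})
    (t := {S | S ⊆ unitRoots W}) (fun F _ v hv => hv.1) ?_ finite_unitRoots.finite_subsets
  intro F hF F' hF' h
  refine face_ext hx hC hF.1 hF'.1 ?_
  rw [(linSpan_face hx hC hF.1).1, (linSpan_face hx hC hF'.1).1]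
  refine mirrorHull_eq_of_forall fun v hv => ?_
  have := Set.ext_iff.mp h v
  simpa [hv] using this

/-- The smallest face of the chamber that contains a given point. -/
theorem exists_face_linSpan_eq [Finite W] (hx : x₀ ∈ mirrorCompl W)
    (hC : ∀ y, y ∈ C ↔ y ∈ chamber W x₀) {c : E} (hc : c ∈ C) :
    ∃ F : PointedCone ℝ E, F.IsFaceOf C ∧ linSpan F = mirrorHull W {c} := by
  set F : PointedCone ℝ E := C ⊓ PointedCone.ofSubmodule (mirrorHull W {c})
  have hmem : ∀ y, y ∈ F ↔ y ∈ C ∧ y ∈ mirrorHull W {c} := fun y => Iff.rfl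
  have hF : F.IsFaceOf C := by
    refine ⟨inf_le_left, fun {x y a} hxC hyC ha h => (hmem _).mpr ⟨hxC, fun v hv hvc => ?_⟩⟩
    have hvc' : ⟪v, c⟫ = 0 := hvc c rfl
    refine forall_unitRoots_of_posRoots hx (fun v hv hvc => ?_) hv hvc'
    have h1 := ((hmem _).mp h).2 v hv.1 fun u hu => (Set.mem_singleton_iff.mp hu) ▸ hvc
    rw [inner_add_right, real_inner_smul_right] at h1
    have h2 := (hC x).mp hxC v hv
    have h3 := (hC y).mp hyC v hv
    have h4 := mul_nonneg ha.le h2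
    have h5 : a * ⟪v, x⟫ = 0 := by linarith
    exact (mul_eq_zero.mp h5).resolve_left ha.ne'
  refine ⟨F, hF, ?_⟩
  rw [(linSpan_face hx hC hF).1]
  have hcF : c ∈ F := (hmem c).mpr ⟨hc, subset_mirrorHull _ rfl⟩
  refine mirrorHull_eq_of_forall fun v hv => ⟨fun h u hu => ?_, fun h u hu => ?_⟩
  · exact (Set.mem_singleton_iff.mp hu) ▸ h c (Submodule.subset_span hcF)
  · have hle : linSpan F ≤ mirrorHull W {c} :=
      Submodule.span_le.mpr fun y hy => ((hmem y).mp hy).2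
    exact hle hu v hv h

/-- If a generic point of an intersection `U` of mirrors is moved into the chamber, then `U` is
moved onto the span of a face. -/
theorem IsGenericIn.exists_face [Finite W] (hx : x₀ ∈ mirrorCompl W)
    (hC : ∀ y, y ∈ C ↔ y ∈ chamber W x₀) {U : Submodule ℝ E} {u : E} (hu : IsGenericIn W U u)
    (hU : mirrorHull W U = U) {g : E ≃ₗᵢ[ℝ] E} (hg : g ∈ W) (hgu : g u ∈ C) :
    ∃ F : PointedCone ℝ E, F.IsFaceOf C ∧ image g U = linSpan F := by
  obtain ⟨F, hF, hspan⟩ := exists_face_linSpan_eq hx hC hgu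
  refine ⟨F, hF, ?_⟩
  rw [hspan, ← image_mirrorHull hg, hu.mirrorHull_eq, hU]

theorem normalizer_le (U : Submodule ℝ E) : normalizer W U ≤ W := fun _ h => h.1

theorem pointFixer_le (U : Submodule ℝ E) : pointFixer W U ≤ W := fun _ h => h.1

theorem finite_normalizer [Finite W] (U : Submodule ℝ E) : Finite (normalizer W U) :=
  Finite.of_injective _ (Subgroup.inclusion_injective (normalizer_le U))

theorem finite_pointFixer [Finite W] (U : Submodule ℝ E) : Finite (pointFixer W U) :=
  Finite.of_injective _ (Subgroup.inclusion_injective (pointFixer_le U))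

theorem card_transporter {U U' : Submodule ℝ E} {g : E ≃ₗᵢ[ℝ] E} (hg : g ∈ W)
    (hU : image g U = U') :
    Nat.card {h : W // image (h : E ≃ₗᵢ[ℝ] E) U = U'} = Nat.card (normalizer W U) := by
  refine Nat.card_congr ⟨fun h => ⟨g⁻¹ * h.1, W.mul_mem (W.inv_mem hg) h.1.2, ?_⟩,
    fun n => ⟨⟨g * (n : E ≃ₗᵢ[ℝ] E), W.mul_mem hg n.2.1⟩, ?_⟩, fun h => ?_, fun n => ?_⟩
  · rw [image_mul, h.2, image_inv_of_eq hU]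
  · change image (g * (n : E ≃ₗᵢ[ℝ] E)) U = U'
    rw [image_mul, n.2.2, hU]
  · exact Subtype.ext (Subtype.ext (mul_inv_cancel_left _ _))
  · exact Subtype.ext (inv_mul_cancel_left _ _)

theorem finrank_image (g : E ≃ₗᵢ[ℝ] E) (U : Submodule ℝ E) :
    Module.finrank ℝ (image g U) = Module.finrank ℝ U :=
  LinearEquiv.finrank_map_eq g.toLinearEquiv U

variable [FiniteDimensional ℝ E] [MeasurableSpace E] [BorelSpace E]

theorem ae_isGenericIn [Finite W] (U : Submodule ℝ E) : ∀ᵐ u : U, IsGenericIn W U u := by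
  have hR : Countable (unitRoots W) := (finite_unitRoots (W := W)).countable
  have h1 : ∀ᵐ u : U, ∀ v : unitRoots W, ⟪(v : E), (u : E)⟫ = 0 → ∀ z ∈ U, ⟪(v : E), z⟫ = 0 := by
    rw [ae_all_iff]
    intro v
    by_cases hv : ∀ z ∈ U, ⟪(v : E), z⟫ = 0
    · exact Filter.Eventually.of_forall fun _ _ => hv
    · have hne : (ℝ ∙ (v : E))ᗮ.comap U.subtype ≠ ⊤ := by
        intro h
        apply hv
        intro z hz
        have : (⟨z, hz⟩ : U) ∈ (ℝ ∙ (v : E))ᗮ.comap U.subtype := h ▸ Submodule.mem_top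
        exact Submodule.mem_orthogonal_singleton_iff_inner_right.mp this
      filter_upwards [ae_notMem_submodule hne] with u hu h0
      exact absurd (Submodule.mem_orthogonal_singleton_iff_inner_right.mpr h0) hu
  filter_upwards [h1] with u hu
  exact ⟨u.2, fun v hv => hu ⟨v, hv⟩⟩

theorem ballFraction_image {g : E ≃ₗᵢ[ℝ] E} {U U' : Submodule ℝ E} (h : image g U = U')
    (S : Set E) :
    ballFraction {u : U | g u ∈ S} = ballFraction {x : U' | (x : E) ∈ S} := by
  subst h
  exact ballFraction_preimage (g.submoduleMap U) {x | (x : E) ∈ S}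

/-- The angle measures of the faces in an equivalence class add up to `|W_F| / |N_F|`. -/
theorem classAngle_eq (hW : IsFiniteReflectionGroup W) (hx : x₀ ∈ mirrorCompl W)
    (hC : ∀ y, y ∈ C ↔ y ∈ chamber W x₀) {k : ℕ} (hF : F ∈ faces C k) :
    classAngle W C F k =
      (Nat.card (pointFixer W (linSpan F)) : ℝ) / Nat.card (normalizer W (linSpan F)) := by
  classical
  have := hW.finite
  have := Fintype.ofFinite W
  have hfin : {F' | F' ∈ faces C k ∧ FaceEquiv W F F'}.Finite :=
    (finite_faces hx hC k).subset fun F' h => h.1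
  set Fs := hfin.toFinset with hFs
  have hmemFs : ∀ F', F' ∈ Fs ↔ F' ∈ faces C k ∧ FaceEquiv W F F' := fun F' => hfin.mem_toFinset
  set L := linSpan F with hL
  set I := (Fs ×ˢ (Finset.univ : Finset W)).filter
    fun q => image (q.2 : E ≃ₗᵢ[ℝ] E) L = linSpan q.1 with hI
  have hmemI : ∀ q, q ∈ I ↔ q.1 ∈ Fs ∧ image (q.2 : E ≃ₗᵢ[ℝ] E) L = linSpan q.1 := by
    intro q; simp [hI]
  have hcardN : ∀ F' ∈ Fs, (Finset.univ.filter fun g : W =>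
      image (g : E ≃ₗᵢ[ℝ] E) L = linSpan F').card = Nat.card (normalizer W L) := by
    intro F' hF'
    obtain ⟨g, hg, hgL⟩ := ((hmemFs F').mp hF').2
    rw [← card_transporter hg hgL, Nat.card_eq_fintype_card, Fintype.card_subtype]
  have hmain := sum_ballFraction_eq (E := L) I
    (fun q => {u : L | (q.2 : E ≃ₗᵢ[ℝ] E) u ∈ q.1}) ?_ (Nat.card (pointFixer W L)) ?_
  · have hsum : ∑ q ∈ I, ballFraction {u : L | (q.2 : E ≃ₗᵢ[ℝ] E) u ∈ q.1} =
        Nat.card (normalizer W L) * ∑ F' ∈ Fs, relAngle F' := by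
      have h1 : ∀ q ∈ I, ballFraction {u : L | (q.2 : E ≃ₗᵢ[ℝ] E) u ∈ q.1} = relAngle q.1 :=
        fun q hq => ballFraction_image ((hmemI q).mp hq).2 q.1
      rw [Finset.sum_congr rfl h1, hI, Finset.sum_filter, Finset.sum_product, Finset.mul_sum]
      refine Finset.sum_congr rfl fun F' hF' => ?_
      rw [← Finset.sum_filter]
      simp only
      rw [Finset.sum_const, hcardN F' hF', nsmul_eq_mul]
    have hN : (Nat.card (normalizer W L) : ℝ) ≠ 0 := by
      have := finite_normalizer (W := W) L
      exact_mod_cast Nat.card_pos.ne'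
    unfold classAngle
    rw [finsum_mem_eq_finite_toFinset_sum _ hfin, eq_div_iff hN, mul_comm, ← hsum, hmain]
  · intro q hq
    have hcl : IsClosed (q.1 : Set E) := by
      have hq1 := ((hmemFs q.1).mp ((hmemI q).mp hq).1).1.1
      have : (q.1 : Set E) = chamber W x₀ ∩ linSpan q.1 := by
        ext y
        exact ((linSpan_face hx hC hq1).2 y).trans (and_congr_left fun _ => hC y)
      rw [this]
      exact isClosed_chamber.inter (linSpan q.1).closed_of_finiteDimensional
    exact (hcl.preimage ((q.2 : E ≃ₗᵢ[ℝ] E).continuous.comp continuous_subtype_val)).measurableSet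
  · filter_upwards [ae_isGenericIn (W := W) L] with u hu
    obtain ⟨g₀, hg₀, hg₀u, -⟩ := exists_mem_chamber (W := W) x₀ (u : E)
    obtain ⟨F₀, hF₀, hspan⟩ := hu.exists_face hx hC (linSpan_face hx hC hF.1).1.symm hg₀
      ((hC _).mpr hg₀u)
    have hF₀s : F₀ ∈ Fs := by
      refine (hmemFs F₀).mpr ⟨⟨hF₀, ?_⟩, g₀, hg₀, hspan⟩
      rw [← hspan, finrank_image]
      exact hF.2
    have := finite_pointFixer (W := W) L
    have := Fintype.ofFinite (pointFixer W L)
    rw [Nat.card_eq_fintype_card, ← Finset.card_univ]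
    symm
    refine Finset.card_bij (fun p _ => (F₀, (⟨g₀ * p, W.mul_mem hg₀ p.2.1⟩ : W))) ?_ ?_ ?_
    · intro p _
      have h1 : (g₀ * (p : E ≃ₗᵢ[ℝ] E)) u = g₀ u := congrArg g₀ (p.2.2 u u.2)
      refine Finset.mem_filter.mpr ⟨(hmemI _).mpr ⟨hF₀s, ?_⟩, ?_⟩
      · change image (g₀ * (p : E ≃ₗᵢ[ℝ] E)) L = _
        rw [image_mul, image_eq_of_mem_pointFixer p.2, hspan]
      · change (g₀ * (p : E ≃ₗᵢ[ℝ] E)) u ∈ F₀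
        rw [h1, (linSpan_face hx hC hF₀).2]
        exact ⟨(hC _).mpr hg₀u, hspan ▸ apply_mem_image u.2⟩
    · intro p _ p' _ h
      have := congrArg Subtype.val (Prod.ext_iff.mp h).2
      exact Subtype.ext (mul_left_cancel this)
    · rintro ⟨F', g⟩ hq
      obtain ⟨hqI, hgu⟩ := Finset.mem_filter.mp hq
      obtain ⟨hF's, hgL⟩ := (hmemI _).mp hqI
      have hF'f := ((hmemFs F').mp hF's).1.1
      have hgu' : (g : E ≃ₗᵢ[ℝ] E) u ∈ F' := hgu
      have hgg : (g : E ≃ₗᵢ[ℝ] E) * g₀⁻¹ ∈ W := W.mul_mem g.2 (W.inv_mem hg₀)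
      have h1 : ((g : E ≃ₗᵢ[ℝ] E) * g₀⁻¹) (g₀ u) = (g : E ≃ₗᵢ[ℝ] E) u :=
        congrArg (g : E ≃ₗᵢ[ℝ] E) (inv_apply_self g₀ u)
      have h2 := eq_of_mem_chamber hW hx hgg hg₀u (h1.symm ▸ (hC _).mp (hF'f.le hgu'))
      have h3 : (g₀⁻¹ * (g : E ≃ₗᵢ[ℝ] E)) u = u := by
        change g₀⁻¹ ((g : E ≃ₗᵢ[ℝ] E) u) = u
        rw [← h1, h2, inv_apply_self]
      have hp := hu.mem_pointFixer hW hx (W.mul_mem (W.inv_mem hg₀) g.2) h3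
      have hF : F₀ = F' := by
        refine face_ext hx hC hF₀ hF'f ?_
        rw [← hspan, ← hgL, ← mul_inv_cancel_left g₀ (g : E ≃ₗᵢ[ℝ] E), image_mul,
          image_eq_of_mem_pointFixer hp]
      refine ⟨⟨_, hp⟩, Finset.mem_univ _, Prod.ext hF (Subtype.ext ?_)⟩
      exact mul_inv_cancel_left g₀ (g : E ≃ₗᵢ[ℝ] E)

end Faces

section Restriction

variable {E : Type*} [NormedAddCommGroup E] [InnerProductSpace ℝ E]
  {W : Subgroup (E ≃ₗᵢ[ℝ] E)} {x₀ : E} {C F : PointedCone ℝ E} {L : Submodule ℝ E}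

theorem apply_mem_orthogonal_of_mem_pointFixer {w : E ≃ₗᵢ[ℝ] E} (hw : w ∈ pointFixer W L) {m : E}
    (hm : m ∈ Lᗮ) : w m ∈ Lᗮ := by
  rw [Submodule.mem_orthogonal'] at hm ⊢
  intro u hu
  rw [inner_isometry_left, ((pointFixer W L).inv_mem hw).2 u hu]
  exact hm u hu

/-- The action of the pointwise fixer of `L` on the orthogonal complement of `L`. -/
def restrictOrthogonal (W : Subgroup (E ≃ₗᵢ[ℝ] E)) (L : Submodule ℝ E) :
    pointFixer W L →* (Lᗮ ≃ₗᵢ[ℝ] Lᗮ) where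
  toFun w :=
    { toFun := fun m => ⟨w.1 m, apply_mem_orthogonal_of_mem_pointFixer w.2 m.2⟩
      invFun := fun m => ⟨w.1⁻¹ m,
        apply_mem_orthogonal_of_mem_pointFixer ((pointFixer W L).inv_mem w.2) m.2⟩
      map_add' := fun a b => Subtype.ext (map_add w.1 (a : E) b)
      map_smul' := fun c a => Subtype.ext (map_smul w.1 c (a : E))
      left_inv := fun m => Subtype.ext (inv_apply_self w.1 m)
      right_inv := fun m => Subtype.ext (apply_inv_self w.1 m)
      norm_map' := fun m => w.1.norm_map m }
  map_one' := by ext; rfl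
  map_mul' a b := by ext; rfl

theorem coe_refl_apply {v : Lᗮ} (hv : ‖v‖ = 1) (m : Lᗮ) :
    ((refl v m : Lᗮ) : E) = refl (v : E) m := by
  rw [refl_apply_of_norm hv, refl_apply_of_norm (v := (v : E)) hv]
  rfl

theorem refl_mem_pointFixer {v : E} (hv : v ∈ unitRoots W) (hvL : v ∈ Lᗮ) :
    refl v ∈ pointFixer W L :=
  ⟨hv.2, fun u hu => (refl_eq_self_iff v u).mpr (Submodule.inner_left_of_mem_orthogonal hu hvL)⟩

theorem restrictOrthogonal_refl {v : Lᗮ} (hv : (v : E) ∈ unitRoots W) :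
    restrictOrthogonal W L ⟨refl (v : E), refl_mem_pointFixer hv v.2⟩ = refl v := by
  ext m
  exact (coe_refl_apply hv.1 m).symm

theorem fixedSpace_restrictOrthogonal_eq_bot_iff (w : pointFixer W L) :
    fixedSpace (restrictOrthogonal W L w) = ⊥ ↔ fixedSpace (w : E ≃ₗᵢ[ℝ] E) ⊓ Lᗮ = ⊥ := by
  rw [Submodule.eq_bot_iff, Submodule.eq_bot_iff]
  constructor
  · rintro h x ⟨hx, hxL⟩
    have := h ⟨x, hxL⟩ (mem_fixedSpace.mpr (Subtype.ext (mem_fixedSpace.mp hx)))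
    exact congrArg Subtype.val this
  · intro h x hx
    exact Subtype.ext (h x ⟨mem_fixedSpace.mpr (congrArg Subtype.val (mem_fixedSpace.mp hx)), x.2⟩)

variable [FiniteDimensional ℝ E]

theorem mem_dualCone_iff {K : PointedCone ℝ E} {y : E} :
    y ∈ dualCone K ↔ ∀ u ∈ K, 0 ≤ ⟪u, y⟫ :=
  Iff.rfl

theorem isometry_ext_of_orthogonal {w w' : E ≃ₗᵢ[ℝ] E} (h1 : ∀ x ∈ L, w x = w' x)
    (h2 : ∀ x ∈ Lᗮ, w x = w' x) : w = w' := by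
  ext x
  obtain ⟨y, hy, z, hz, rfl⟩ := L.exists_add_mem_mem_orthogonal x
  rw [map_add, map_add, h1 y hy, h2 z hz]

theorem restrictOrthogonal_injective : Function.Injective (restrictOrthogonal W L) := by
  intro a b h
  refine Subtype.ext (isometry_ext_of_orthogonal (L := L)
    (fun x hx => (a.2.2 x hx).trans (b.2.2 x hx).symm) fun x hx => ?_)
  exact congrArg (fun f : Lᗮ ≃ₗᵢ[ℝ] Lᗮ => (f ⟨x, hx⟩ : E)) h

theorem mem_unitRoots_range {v : Lᗮ} :
    v ∈ unitRoots (restrictOrthogonal W L).range ↔ (v : E) ∈ unitRoots W := by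
  constructor
  · rintro ⟨hv, w, hw⟩
    have hn : ‖(v : E)‖ = 1 := hv
    refine ⟨hn, ?_⟩
    have : refl (v : E) = w := by
      refine isometry_ext_of_orthogonal (L := L) (fun x hx => ?_) fun x hx => ?_
      · rw [w.2.2 x hx, refl_eq_self_iff]
        exact Submodule.inner_left_of_mem_orthogonal hx v.2
      · rw [← coe_refl_apply hv ⟨x, hx⟩, ← hw]
        rfl
    rw [this]
    exact w.2.1
  · intro hv
    exact ⟨hv.1, _, restrictOrthogonal_refl hv⟩

theorem isFiniteReflectionGroup_range (hW : IsFiniteReflectionGroup W) (hx : x₀ ∈ mirrorCompl W)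
    {p : E} (hp : IsGenericIn W L p) :
    IsFiniteReflectionGroup (restrictOrthogonal W L).range := by
  have := hW.finite
  have := finite_pointFixer (W := W) L
  refine ⟨Set.finite_range (restrictOrthogonal W L),
    (fun v => refl v) '' unitRoots (restrictOrthogonal W L).range, ?_, le_antisymm ?_ ?_⟩
  · rintro _ ⟨v, hv, rfl⟩
    exact ⟨v, ne_zero_of_mem_unitRoots hv, rfl⟩
  · rintro _ ⟨w, rfl⟩
    have h1 := mem_reflGroup_of_apply_eq hW hx w.2.1 (w.2.2 p hp.1)
    have hle : reflGroup {a | a ∈ unitRoots W ∧ ⟪a, p⟫ = 0} ≤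
        ((Subgroup.closure ((fun v => refl v) '' unitRoots (restrictOrthogonal W L).range)).comap
          (restrictOrthogonal W L)).map (pointFixer W L).subtype := by
      refine (Subgroup.closure_le _).mpr ?_
      rintro _ ⟨v, ⟨hv, hvp⟩, rfl⟩
      have hvL : v ∈ Lᗮ := (Submodule.mem_orthogonal' _ _).mpr fun u hu => hp.2 v hv hvp u hu
      refine ⟨⟨refl v, refl_mem_pointFixer hv hvL⟩, Subgroup.mem_comap.mpr ?_, rfl⟩
      rw [restrictOrthogonal_refl (v := ⟨v, hvL⟩) hv]
      exact Subgroup.subset_closure ⟨⟨v, hvL⟩, mem_unitRoots_range.mpr hv, rfl⟩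
    obtain ⟨w', hw', h2⟩ := hle h1
    have : w' = w := Subtype.ext h2
    exact this ▸ hw'
  · refine (Subgroup.closure_le (restrictOrthogonal W L).range).mpr ?_
    rintro _ ⟨v, hv, rfl⟩
    exact hv.2

theorem inner_orthogonalProjectionOnto (v : Lᗮ) (x : E) :
    ⟪v, Lᗮ.orthogonalProjectionOnto x⟫ = ⟪(v : E), x⟫ :=
  Submodule.inner_orthogonalProjectionOnto_eq_of_mem_left v x

theorem orthogonalProjectionOnto_mem_mirrorCompl (hx : x₀ ∈ mirrorCompl W) :
    Lᗮ.orthogonalProjectionOnto x₀ ∈ mirrorCompl (restrictOrthogonal W L).range := by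
  refine mem_mirrorCompl_of_unitRoots fun v hv => ?_
  rw [inner_orthogonalProjectionOnto]
  exact inner_ne_zero_of_mem_unitRoots hx (mem_unitRoots_range.mp hv)

theorem mem_posRoots_range {v : Lᗮ} :
    v ∈ posRoots (restrictOrthogonal W L).range (Lᗮ.orthogonalProjectionOnto x₀) ↔
      (v : E) ∈ posRoots W x₀ := by
  exact and_congr mem_unitRoots_range (by rw [inner_orthogonalProjectionOnto])

/-- The quotient of the chamber by a face is a chamber of the pointwise fixer of the face. -/
theorem mem_quotCone_iff [Finite W] (hx : x₀ ∈ mirrorCompl W)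
    (hC : ∀ y, y ∈ C ↔ y ∈ chamber W x₀) (hF : F.IsFaceOf C) (y : (linSpan F)ᗮ) :
    y ∈ quotCone C F ↔ y ∈ chamber (restrictOrthogonal W (linSpan F)).range
      ((linSpan F)ᗮ.orthogonalProjectionOnto x₀) := by
  constructor
  · intro h v hv
    obtain ⟨c, hc, rfl⟩ := PointedCone.mem_map.mp h
    change 0 ≤ ⟪v, (linSpan F)ᗮ.orthogonalProjectionOnto c⟫
    rw [inner_orthogonalProjectionOnto]
    exact (hC c).mp hc _ (mem_posRoots_range.mp hv)
  · intro hy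
    obtain ⟨p, hpF, hp⟩ := exists_isGenericIn_face hx hC hF
    obtain ⟨N, -, h⟩ := exists_smul_add_mem_chamber (z := (y : E)) ((hC p).mp (hF.le hpF))
      fun v hv hvp => by
        have hvL : v ∈ (linSpan F)ᗮ :=
          (Submodule.mem_orthogonal' _ _).mpr fun u hu => hp.2 v hv.1 hvp u hu
        exact hy ⟨v, hvL⟩ (mem_posRoots_range.mpr hv)
    refine PointedCone.mem_map.mpr ⟨N • p + y, (hC _).mpr (h N le_rfl), ?_⟩
    change (linSpan F)ᗮ.orthogonalProjectionOnto (N • p + (y : E)) = y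
    have hp0 : (linSpan F)ᗮ.orthogonalProjectionOnto p = 0 := by
      rw [Submodule.orthogonalProjectionOnto_eq_zero_iff]
      exact Submodule.le_orthogonal_orthogonal _ hp.1
    rw [map_add, map_smul, hp0, smul_zero, zero_add,
      Submodule.orthogonalProjectionOnto_mem_subspace_eq_self]

theorem coe_dualCone_quotCone [Finite W] (hx : x₀ ∈ mirrorCompl W)
    (hC : ∀ y, y ∈ C ↔ y ∈ chamber W x₀) (hF : F.IsFaceOf C) :
    (dualCone (quotCone C F) : Set (linSpan F)ᗮ) =
      dualChamber (restrictOrthogonal W (linSpan F)).range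
        ((linSpan F)ᗮ.orthogonalProjectionOnto x₀) := by
  ext y
  exact mem_dualCone_iff.trans (forall_congr' fun u => by rw [mem_quotCone_iff hx hC hF])

theorem linSpan_dualCone_quotCone [Finite W] (hx : x₀ ∈ mirrorCompl W)
    (hC : ∀ y, y ∈ C ↔ y ∈ chamber W x₀) (hF : F.IsFaceOf C) :
    linSpan (dualCone (quotCone C F)) = ⊤ := by
  rw [← Submodule.orthogonal_eq_bot_iff, Submodule.eq_bot_iff]
  intro z hz
  have hzL : (z : E) ∈ linSpan F := by
    obtain ⟨p, -, hp⟩ := exists_isGenericIn_face hx hC hF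
    refine (linSpan_face hx hC hF).1.ge fun v hv hvL => ?_
    refine forall_unitRoots_of_posRoots hx (fun v hv hvp => ?_) hv (hvL p hp.1)
    have hvL : v ∈ (linSpan F)ᗮ :=
      (Submodule.mem_orthogonal' _ _).mpr fun u hu => hp.2 v hv.1 hvp u hu
    have hvd : (⟨v, hvL⟩ : (linSpan F)ᗮ) ∈ dualCone (quotCone C F) := by
      refine mem_dualCone_iff.mpr fun u hu => ?_
      rw [real_inner_comm]
      exact (mem_quotCone_iff hx hC hF u).mp hu _ (mem_posRoots_range.mpr hv)
    exact (Submodule.mem_orthogonal _ _).mp hz _ (Submodule.subset_span hvd)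
  exact Subtype.ext ((Submodule.orthogonal_disjoint (linSpan F)).le_bot ⟨hzL, z.2⟩)

variable [MeasurableSpace E] [BorelSpace E]

theorem relAngle_eq_ballFraction {K : PointedCone ℝ E} (h : linSpan K = ⊤) :
    relAngle K = ballFraction (K : Set E) := by
  have key : ∀ U : Submodule ℝ E, U = ⊤ →
      ballFraction {x : U | (x : E) ∈ K} = ballFraction (K : Set E) := by
    rintro _ rfl
    exact ballFraction_preimage (LinearIsometryEquiv.ofTop E (⊤ : Submodule ℝ E) rfl) (K : Set E)
  exact key _ h

theorem card_mul_relAngle_dualCone (hW : IsFiniteReflectionGroup W) (hx : x₀ ∈ mirrorCompl W)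
    (hC : ∀ y, y ∈ C ↔ y ∈ chamber W x₀) (hF : F.IsFaceOf C) :
    Nat.card (pointFixer W (linSpan F)) * relAngle (dualCone (quotCone C F)) =
      Nat.card (regSet W (linSpan F)) := by
  have := hW.finite
  obtain ⟨p, -, hp⟩ := exists_isGenericIn_face hx hC hF
  have h := card_mul_ballFraction_dualChamber (isFiniteReflectionGroup_range hW hx hp)
    (orthogonalProjectionOnto_mem_mirrorCompl hx)
  rw [relAngle_eq_ballFraction (linSpan_dualCone_quotCone hx hC hF),
    coe_dualCone_quotCone hx hC hF]
  have e := MonoidHom.ofInjective (restrictOrthogonal_injective (W := W) (L := linSpan F))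
  rw [Nat.card_congr e.toEquiv, h]
  congr 1
  refine (Nat.card_congr (Equiv.ofBijective
    (fun w : regSet W (linSpan F) => (⟨⟨restrictOrthogonal W _ ⟨w.1, w.2.1⟩, _, rfl⟩,
      (fixedSpace_restrictOrthogonal_eq_bot_iff _).mpr w.2.2⟩ :
      {w : (restrictOrthogonal W (linSpan F)).range | fixedSpace w.1 = ⊥})) ⟨?_, ?_⟩)).symm
  · intro a b hab
    have h1 := congrArg (fun w => w.1.1) hab
    have h2 := restrictOrthogonal_injective h1
    exact Subtype.ext (congrArg (fun w : pointFixer W (linSpan F) => (w : E ≃ₗᵢ[ℝ] E)) h2)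
  · rintro ⟨⟨_, w, rfl⟩, hw⟩
    exact ⟨⟨w, w.2, (fixedSpace_restrictOrthogonal_eq_bot_iff w).mp hw⟩, rfl⟩

end Restriction

section Counting

variable {E : Type*} [NormedAddCommGroup E] [InnerProductSpace ℝ E]
  {W : Subgroup (E ≃ₗᵢ[ℝ] E)} {x₀ : E} {C F : PointedCone ℝ E} {L : Submodule ℝ E}

theorem fixedSpace_conj (w g : E ≃ₗᵢ[ℝ] E) :
    fixedSpace (g * w * g⁻¹) = image g (fixedSpace w) := by
  ext x
  rw [mem_image_iff, mem_fixedSpace, mem_fixedSpace]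
  change g (w (g⁻¹ x)) = x ↔ _
  constructor
  · intro h
    nth_rw 2 [← h]
    rw [inv_apply_self]
  · intro h
    rw [h, apply_inv_self]

variable [FiniteDimensional ℝ E]

theorem mem_regSet_iff {w : E ≃ₗᵢ[ℝ] E} : w ∈ regSet W L ↔ w ∈ W ∧ fixedSpace w = L := by
  constructor
  · rintro ⟨hw, h⟩
    refine ⟨hw.1, ?_⟩
    have hle : L ≤ fixedSpace w := fun u hu => mem_fixedSpace.mpr (hw.2 u hu)
    have := Submodule.sup_orthogonal_inf_of_hasOrthogonalProjection hle
    rw [inf_comm, h, sup_bot_eq] at this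
    exact this.symm
  · rintro ⟨hw, rfl⟩
    exact ⟨⟨hw, fun u hu => mem_fixedSpace.mp hu⟩, (Submodule.orthogonal_disjoint _).eq_bot⟩

/-- The elements of `W` whose fixed space is a translate of `L`. -/
def fixConjSet (W : Subgroup (E ≃ₗᵢ[ℝ] E)) (L : Submodule ℝ E) : Set (E ≃ₗᵢ[ℝ] E) :=
  {w | w ∈ W ∧ ∃ g ∈ W, image g L = fixedSpace w}

theorem card_fixConjSet_mul [Finite W] (L : Submodule ℝ E) :
    Nat.card (fixConjSet W L) * Nat.card (normalizer W L) =
      Nat.card W * Nat.card (regSet W L) := by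
  classical
  have := Fintype.ofFinite W
  have hfin : (fixConjSet W L).Finite := (Set.toFinite (W : Set _)).subset fun w hw => hw.1
  have := hfin.fintype
  rw [Nat.card_eq_fintype_card (α := fixConjSet W L), Nat.card_eq_fintype_card (α := W),
    ← Finset.card_univ, ← Finset.card_univ]
  refine Finset.card_mul_eq_card_mul
    (fun (w : fixConjSet W L) (g : W) => image (g : E ≃ₗᵢ[ℝ] E) L = fixedSpace w.1) ?_ ?_
  · rintro ⟨w, hw, g, hg, hgL⟩ -
    rw [← card_transporter hg hgL, Nat.card_eq_fintype_card, Fintype.card_subtype]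
    rfl
  · intro g _
    have h1 : ∀ r : regSet W L, (g : E ≃ₗᵢ[ℝ] E) * r.1 * (g : E ≃ₗᵢ[ℝ] E)⁻¹ ∈ fixConjSet W L ∧
        image (g : E ≃ₗᵢ[ℝ] E) L = fixedSpace ((g : E ≃ₗᵢ[ℝ] E) * r.1 * (g : E ≃ₗᵢ[ℝ] E)⁻¹) := by
      intro r
      obtain ⟨hr, hrL⟩ := mem_regSet_iff.mp r.2
      have h2 := fixedSpace_conj (r : E ≃ₗᵢ[ℝ] E) g
      rw [hrL] at h2
      exact ⟨⟨W.mul_mem (W.mul_mem g.2 hr) (W.inv_mem g.2), g, g.2, h2.symm⟩, h2.symm⟩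
    have e : Nat.card (regSet W L) = Nat.card {w : fixConjSet W L //
        image (g : E ≃ₗᵢ[ℝ] E) L = fixedSpace w.1} := by
      refine Nat.card_congr (Equiv.ofBijective (fun r => ⟨⟨_, (h1 r).1⟩, (h1 r).2⟩) ⟨?_, ?_⟩)
      · intro a b hab
        have h2 := congrArg (fun w => w.1.1) hab
        exact Subtype.ext (mul_left_cancel (mul_right_cancel h2))
      · rintro ⟨⟨w, hw⟩, hwL⟩
        refine ⟨⟨(g : E ≃ₗᵢ[ℝ] E)⁻¹ * w * g, mem_regSet_iff.mpr
          ⟨W.mul_mem (W.mul_mem (W.inv_mem g.2) hw.1) g.2, ?_⟩⟩, ?_⟩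
        · have h2 := fixedSpace_conj w (g : E ≃ₗᵢ[ℝ] E)⁻¹
          rw [inv_inv] at h2
          rw [h2]
          exact image_inv_of_eq hwL
        · refine Subtype.ext (Subtype.ext ?_)
          change (g : E ≃ₗᵢ[ℝ] E) * ((g : E ≃ₗᵢ[ℝ] E)⁻¹ * w * g) * (g : E ≃ₗᵢ[ℝ] E)⁻¹ = w
          group
    rw [e, Nat.card_eq_fintype_card, Fintype.card_subtype]
    rfl

theorem exists_isGenericIn [Finite W] (U : Submodule ℝ E) : ∃ u, IsGenericIn W U u := by
  borelize E
  obtain ⟨u, hu⟩ := (ae_isGenericIn (W := W) U).exists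
  exact ⟨u, hu⟩

theorem card_fixDimSet (hW : IsFiniteReflectionGroup W) (hx : x₀ ∈ mirrorCompl W)
    (hC : ∀ y, y ∈ C ↔ y ∈ chamber W x₀) {k : ℕ} {R : Finset (PointedCone ℝ E)}
    (hR : IsFaceTransversal W C k R) :
    Nat.card (fixDimSet W k) = ∑ F ∈ R, Nat.card (fixConjSet W (linSpan F)) := by
  classical
  have := hW.finite
  have hfin : ∀ L, (fixConjSet W L).Finite := fun L =>
    (Set.toFinite (W : Set _)).subset fun w hw => hw.1
  have hunion : fixDimSet W k = (R.biUnion fun F => (hfin (linSpan F)).toFinset) := by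
    ext w
    simp only [Finset.coe_biUnion, Set.Finite.coe_toFinset, Set.mem_iUnion, exists_prop,
      Finset.mem_coe]
    constructor
    · rintro ⟨hw, hk⟩
      obtain ⟨u, hu⟩ := exists_isGenericIn (W := W) (fixedSpace w)
      obtain ⟨g, hg, hgu, -⟩ := exists_mem_chamber (W := W) x₀ u
      obtain ⟨F₀, hF₀, hspan⟩ := hu.exists_face hx hC (hu.mirrorHull_fixedSpace hW hx hw) hg
        ((hC _).mpr hgu)
      have hF₀k : F₀ ∈ faces C k := ⟨hF₀, by rw [← hspan, finrank_image, hk]⟩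
      obtain ⟨F, ⟨hFR, h, hh, hhF⟩, -⟩ := hR.2 F₀ hF₀k
      refine ⟨F, hFR, hw, (h * g)⁻¹, W.inv_mem (W.mul_mem hh hg), ?_⟩
      apply image_inv_of_eq
      rw [image_mul, hspan, hhF]
    · rintro ⟨F, hFR, hw, g, hg, hgF⟩
      exact ⟨hw, by rw [← hgF, finrank_image]; exact (hR.1 F hFR).2⟩
  rw [hunion, Nat.card_coe_set_eq, Set.ncard_coe_finset, Finset.card_biUnion]
  · refine Finset.sum_congr rfl fun F _ => ?_
    rw [Nat.card_coe_set_eq, Set.ncard_eq_toFinset_card _ (hfin _)]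
  · intro F hF F' hF' hne
    rw [Function.onFun, Finset.disjoint_left]
    intro w hw hw'
    rw [Set.Finite.mem_toFinset] at hw hw'
    obtain ⟨-, g, hg, hgF⟩ := hw
    obtain ⟨-, g', hg', hgF'⟩ := hw'
    refine hne ((hR.2 F (hR.1 F hF)).unique ⟨hF, 1, W.one_mem, image_one _⟩
      ⟨hF', g'⁻¹ * g, W.mul_mem (W.inv_mem hg') hg, ?_⟩)
    rw [image_mul, hgF]
    exact image_inv_of_eq hgF'

end Counting

end AngleMeasure

end

open AngleMeasure in
theorem mainTheorem2 {V : Type*} [NormedAddCommGroup V] [InnerProductSpace ℝ V]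
    [FiniteDimensional ℝ V] [MeasurableSpace V] [BorelSpace V]
    (W : Subgroup (V ≃ₗᵢ[ℝ] V)) (hW : IsFiniteReflectionGroup W)
    (C : PointedCone ℝ V) (hC : IsFundamentalCone W C) (k : ℕ) :
    (faces C k).Finite ∧
    (∀ F ∈ faces C k,
      classAngle W C F k =
        (Nat.card (pointFixer W (linSpan F)) : ℝ) / Nat.card (normalizer W (linSpan F))) ∧
    (∀ R : Finset (PointedCone ℝ V), IsFaceTransversal W C k R →
      ∑ F ∈ R, (Nat.card (regSet W (linSpan F)) : ℝ) / Nat.card (normalizer W (linSpan F)) =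
        ∑ F ∈ R, classAngle W C F k *
          relAngle (dualCone (quotCone C F)) ∧
      ∑ F ∈ R, classAngle W C F k *
          relAngle (dualCone (quotCone C F)) =
        (Nat.card (fixDimSet W k) : ℝ) / Nat.card W) := by
  have := hW.finite
  obtain ⟨x₀, hx, hCx⟩ := hC
  have hC : ∀ y, y ∈ C ↔ y ∈ chamber W x₀ := fun y =>
    (hCx y).trans (mem_chamber_iff hx y).symm
  refine ⟨finite_faces hx hC k, fun F hF => classAngle_eq hW hx hC hF, fun R hR => ?_⟩
  have h1 : ∀ F ∈ R,
      (Nat.card (regSet W (linSpan F)) : ℝ) / Nat.card (normalizer W (linSpan F)) =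
        classAngle W C F k * relAngle (dualCone (quotCone C F)) := by
    intro F hF
    rw [classAngle_eq hW hx hC (hR.1 F hF), div_mul_eq_mul_div,
      card_mul_relAngle_dualCone hW hx hC (hR.1 F hF).1]
  have h2 : ∀ F ∈ R,
      (Nat.card (regSet W (linSpan F)) : ℝ) / Nat.card (normalizer W (linSpan F)) =
        Nat.card (fixConjSet W (linSpan F)) / Nat.card W := by
    intro F _
    have := finite_normalizer (W := W) (linSpan F)
    have hN : (Nat.card (normalizer W (linSpan F)) : ℝ) ≠ 0 := by exact_mod_cast Nat.card_pos.ne'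
    have hWc : (Nat.card W : ℝ) ≠ 0 := by exact_mod_cast Nat.card_pos.ne'
    rw [div_eq_div_iff hN hWc, mul_comm]
    exact_mod_cast (card_fixConjSet_mul (W := W) (linSpan F)).symm
  refine ⟨Finset.sum_congr rfl h1, ?_⟩
  rw [← Finset.sum_congr rfl h1, Finset.sum_congr rfl h2, ← Finset.sum_div,
    card_fixDimSet hW hx hC hR, Nat.cast_sum]
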